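/- Let $K$ be a field and, for a finite simple graph $G$ and an integer $r\ge 1$, let $I_r(G)\subseteq R=K[x_v : v\in V(G)]$ be the ideal generated by the monomials $\prod_{v\in S}x_v$, where $S$ runs over all sets of $r+1$ vertices whose induced subgraph $G[S]$ is connected. A homogeneous ideal $I\subseteq R$ generated in a single degree $d$ has a linear resolution if its minimal graded free resolution has the form $0\to R(-d-p)^{b_p}\to\cdots\to R(-d-1)^{b_1}\to R(-d)^{b_0}\to I\to 0$ (the zero ideal is included, with all $b_i=0$). Let $\mathcal G(I)$ denote the set of minimal monomial generators of a monomial ideal $I$ generated in a single degree. Such an $I$ is polymatroidal if for all $u,v\in\mathcal G(I)$ and every variable $x$ with $\deg_{x}(u)>\deg_{x}(v)$ there is a variable $y$ with $\deg_{y}(u)<\deg_{y}(v)$ and $y\,(u/x)\in\mathcal G(I)$. Given an ordering $x_1,\dots,x_n$ of the variables, $I$ is weakly polymatroidal if, whenever $f=\prod x_i^{a_i}$ and $g=\prod x_i^{b_i}$ in $\mathcal G(I)$ satisfy $a_i=b_i$ for $i<t$ and $a_t>b_t$, there is $\ell>t$ such that $x_\ell\mid g$ and $x_t\,(g/x_\ell)\in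 I$. **Theorem.** Let $r\ge 2$, let $T$ be a finite tree with maximum degree $\Delta(T)\le r$, and let $G=\overline T$ be its complement. Then 1. for every $q\ge 1$ the ideal $I_r(G)^q$ has a linear resolution; 2. if $r=2$, then $T$ is a path, and for every $q\ge1$ the ideal $I_2(G)^q$ is weakly polymatroidal with respect to the ordering of the variables along the path; 3. if $r\ge 3$, then $I_r(G)$ is polymatroidal. -/

import Mathlib

noncomputable section

universe u v

/-- The `r`-connected ideal `I_r(G)`: it is generated by the squarefree monomials
`∏_{x ∈ S} x`, where `S` runs over the sets of `r + 1` vertices such that `G[S]` is connected. -/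
def connectedIdeal {V : Type u} (K : Type v) [Field K] (G : SimpleGraph V) (r : ℕ) :
    Ideal (MvPolynomial V K) :=
  Ideal.span {f | ∃ S : Finset V, S.card = r + 1 ∧ (G.induce (S : Set V)).Connected ∧
    f = ∏ x ∈ S, MvPolynomial.X x}

/-! ### Graded free resolutions -/

/-- A matrix entry `f` is admissible for a degree-preserving map `R(-b) → R(-a)`:
it is zero or homogeneous of degree `b - a` (with `b ≥ a`). -/
def IsGradedEntry {σ : Type u} {K : Type v} [Field K] (a b : ℤ) (f : MvPolynomial σ K) : Prop :=
  f ≠ 0 → ∃ e : ℕ, f.IsHomogeneous e ∧ a + e = b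

/-- A graded free resolution of finite length
`0 → F_p → ⋯ → F_1 → F_0 → I → 0` of an ideal `I` of `R = K[x_s : s ∈ σ]`, where
`F_i = ⨁_{k ∈ gen i} R(-shift i k)` is free of finite rank. -/
structure GradedFreeResolution {σ : Type u} {K : Type v} [Field K]
    (I : Ideal (MvPolynomial σ K)) where
  /-- the index set of the homogeneous basis of `F_i` -/
  gen : ℕ → Type
  finite_gen : ∀ i, Finite (gen i)
  /-- the degrees of the homogeneous basis elements of `F_i` -/
  shift : (i : ℕ) → gen i → ℤ
  /-- the differential `F_{i+1} → F_i` -/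
  d : (i : ℕ) → (gen (i + 1) →₀ MvPolynomial σ K) →ₗ[MvPolynomial σ K]
    (gen i →₀ MvPolynomial σ K)
  /-- the augmentation `F_0 → I ⊆ R` -/
  aug : (gen 0 →₀ MvPolynomial σ K) →ₗ[MvPolynomial σ K] MvPolynomial σ K
  graded_d : ∀ i k j, IsGradedEntry (shift i j) (shift (i + 1) k) (d i (Finsupp.single k 1) j)
  graded_aug : ∀ k, IsGradedEntry 0 (shift 0 k) (aug (Finsupp.single k 1))
  range_aug : LinearMap.range aug = I
  exact_zero : Function.Exact (d 0) aug
  exact_succ : ∀ i, Function.Exact (d (i + 1)) (d i)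
  finite_length : ∃ p : ℕ, ∀ i, p < i → IsEmpty (gen i)

/-- The resolution is minimal: the differentials have image in `𝔪 F_i`, where `𝔪` is the ideal
of the variables, that is, no matrix entry has a nonzero constant term. -/
def GradedFreeResolution.IsMinimal {σ : Type u} {K : Type v} [Field K]
    {I : Ideal (MvPolynomial σ K)} (F : GradedFreeResolution I) : Prop :=
  ∀ i k j, MvPolynomial.constantCoeff (F.d i (Finsupp.single k 1) j) = 0

/-- The ideal `I` has a linear resolution: for some `d`, its minimal graded free resolution
(which is unique up to isomorphism) is `d`-linear, i.e. `F_i = R(-d-i)^{b_i}` for all `i`. -/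
def HasLinearResolution {σ : Type u} {K : Type v} [Field K]
    (I : Ideal (MvPolynomial σ K)) : Prop :=
  ∃ (d : ℕ) (F : GradedFreeResolution I), F.IsMinimal ∧
    ∀ (i : ℕ) (k : F.gen i), F.shift i k = (d : ℤ) + i

/-! ### Polymatroidal and weakly polymatroidal ideals -/

/-- The exponent vectors of the minimal monomial generators of `I`: the monomials of `I` that
are minimal with respect to divisibility. -/
def minimalMonomials {σ : Type u} {K : Type v} [Field K] (I : Ideal (MvPolynomial σ K)) :
    Set (σ →₀ ℕ) :=
  {m | Minimal (fun m' : σ →₀ ℕ => MvPolynomial.monomial m' (1 : K) ∈ I) m}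

/-- `I` is a monomial ideal generated in a single degree. -/
def IsEquigeneratedMonomialIdeal {σ : Type u} {K : Type v} [Field K]
    (I : Ideal (MvPolynomial σ K)) : Prop :=
  I = Ideal.span ((fun m => MvPolynomial.monomial m (1 : K)) '' minimalMonomials I) ∧
    ∃ d : ℕ, ∀ m ∈ minimalMonomials I, m.degree = d

/-- `I` is polymatroidal: it is a monomial ideal generated in a single degree, and for
`u, v ∈ 𝒢(I)` with `deg_{x_i} u > deg_{x_i} v` there is `j` with `deg_{x_j} u < deg_{x_j} v`
and `x_j (u / x_i) ∈ 𝒢(I)`. -/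
def IsPolymatroidal {σ : Type u} {K : Type v} [Field K] (I : Ideal (MvPolynomial σ K)) : Prop :=
  IsEquigeneratedMonomialIdeal I ∧
    ∀ f ∈ minimalMonomials I, ∀ g ∈ minimalMonomials I, ∀ i, g i < f i →
      ∃ j, f j < g j ∧ f - Finsupp.single i 1 + Finsupp.single j 1 ∈ minimalMonomials I

/-- `I` is weakly polymatroidal with respect to the ordering `x_1 < ⋯ < x_n` of the variables
given by `e`: it is a monomial ideal generated in a single degree, and whenever `f, g ∈ 𝒢(I)` have
the same exponents at all variables before `t` while `f` has the larger exponent at `t`, there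
is a variable `l` after `t` that divides `g` and satisfies `x_t (g / x_l) ∈ I`. -/
def IsWeaklyPolymatroidal {σ : Type u} {K : Type v} [Field K] {n : ℕ} (e : σ ≃ Fin n)
    (I : Ideal (MvPolynomial σ K)) : Prop :=
  IsEquigeneratedMonomialIdeal I ∧
    ∀ f ∈ minimalMonomials I, ∀ g ∈ minimalMonomials I, ∀ t,
      (∀ s, e s < e t → f s = g s) → g t < f t →
        ∃ l, e t < e l ∧ 0 < g l ∧
          MvPolynomial.monomial (g - Finsupp.single l 1 + Finsupp.single t 1) (1 : K) ∈ I

end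

/-! Put `k = r + 1`. A set of `k` vertices is connected in the complement of a tree `T` unless it is
spanned by a star of `T` (`connected_induce_compl_iff`). So the generators are all squarefree
monomials of degree `k` except those of these bad sets. Since `Δ(T) ≤ r`, a bad set is a closed
neighbourhood, and two bad sets share at most two vertices.

The generators of the `q`-th power are the lattice points `m` of a polytope: `m i ≤ q`, total degree
`q k`, and sum at most `q (k - 1)` over each bad set (`boundedExponents`). To decompose such a
point, write it as a sum of `q` sets of size `k`, then remove the bad ones by swapping elements with
other summands.

In the exchange step, moving a unit of `g` from `l` to `t` can only break a tight constraint that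
contains `t` but not `l`. It therefore suffices that one tight bad set through `t` has all its later
elements in every other one. For `r ≥ 3` a count shows that at most one tight set contains `t`; for
`r = 2` the tree is a path, bad sets are triples of consecutive vertices, and their parts after `t`
are nested. The weak exchange property gives linear quotients in decreasing lexicographic order,
hence a linear resolution by the horseshoe lemma. For `r ≥ 3`, polymatroidality is a direct exchange
argument on sets. -/

open MvPolynomial

/-! ### Linear resolutions as iterated linear syzygies. -/

section LinearResolutions

variable {σ : Type u} {K : Type v} [Field K]

/-- The grading induced on the kernel of `R(0)^ι → M`, shifted such that the linear syzygies
have degree `0`. -/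
def syzygyGrading {M : Type (max u v)} [AddCommGroup M] [Module (MvPolynomial σ K) M]
    {ι : Type} (m : ι → M) (e : ℕ) :
    AddSubgroup (LinearMap.ker (Finsupp.linearCombination (MvPolynomial σ K) m)) where
  carrier := {f | ∀ i, (f.1 i).IsHomogeneous (e + 1)}
  zero_mem' _ := isHomogeneous_zero _ _ _
  add_mem' hf hg i := (hf i).add (hg i)
  neg_mem' hf i := (hf i).neg

theorem mem_syzygyGrading {M : Type (max u v)} [AddCommGroup M] [Module (MvPolynomial σ K) M]
    {ι : Type} (m : ι → M) (e : ℕ)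
    (f : LinearMap.ker (Finsupp.linearCombination (MvPolynomial σ K) m)) :
    f ∈ syzygyGrading m e ↔ ∀ i, (f.1 i).IsHomogeneous (e + 1) := Iff.rfl

/-- The module `M` with graded pieces `gr` is generated in degree `0` and has a linear free
resolution of length at most `p`. -/
def HasLinearSyzygies : (p : ℕ) → (M : Type (max u v)) → [AddCommGroup M] →
    [Module (MvPolynomial σ K) M] → (ℕ → AddSubgroup M) → Prop
  | 0, M, _, _, _ => Subsingleton M
  | p + 1, M, _, _, gr => ∃ (ι : Type) (_ : Finite ι) (m : ι → M),
      (∀ i, m i ∈ gr 0) ∧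
      Function.Surjective (Finsupp.linearCombination (MvPolynomial σ K) m) ∧
      -- Graded surjectivity is a separate demand, because `gr` is not assumed to decompose `M`.
      (∀ e, ∀ x ∈ gr e, ∃ f : ι →₀ MvPolynomial σ K, (∀ i, (f i).IsHomogeneous e) ∧
        Finsupp.linearCombination (MvPolynomial σ K) m f = x) ∧
      HasLinearSyzygies p (LinearMap.ker (Finsupp.linearCombination (MvPolynomial σ K) m))
        (syzygyGrading m)

theorem HasLinearSyzygies.of_subsingleton (p : ℕ) (M : Type (max u v)) [AddCommGroup M]
    [Module (MvPolynomial σ K) M] [Subsingleton M] (gr : ℕ → AddSubgroup M) :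
    HasLinearSyzygies (σ := σ) (K := K) p M gr := by
  induction p generalizing M with
  | zero => assumption
  | succ p ih =>
    exact ⟨Empty, inferInstance, Empty.elim, fun i => i.elim, fun x => ⟨0, Subsingleton.elim _ _⟩,
      fun e x _ => ⟨0, fun i => i.elim, Subsingleton.elim _ _⟩, ih _ _⟩

theorem HasLinearSyzygies.succ {p : ℕ} {M : Type (max u v)} [AddCommGroup M]
    [Module (MvPolynomial σ K) M] {gr : ℕ → AddSubgroup M}
    (h : HasLinearSyzygies (σ := σ) (K := K) p M gr) :
    HasLinearSyzygies (σ := σ) (K := K) (p + 1) M gr := by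
  induction p generalizing M with
  | zero =>
    have : Subsingleton M := h
    exact .of_subsingleton _ _ _
  | succ p ih =>
    obtain ⟨ι, hι, m, h1, h2, h3, h4⟩ := h
    exact ⟨ι, hι, m, h1, h2, h3, ih h4⟩

theorem HasLinearSyzygies.mono {p q : ℕ} (hpq : p ≤ q) {M : Type (max u v)} [AddCommGroup M]
    [Module (MvPolynomial σ K) M] {gr : ℕ → AddSubgroup M}
    (h : HasLinearSyzygies (σ := σ) (K := K) p M gr) :
    HasLinearSyzygies (σ := σ) (K := K) q M gr := by
  induction hpq with
  | refl => exact h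
  | step _ ih => exact ih.succ

theorem linearCombination_sumElim_apply {R M ι κ : Type*} [CommRing R] [AddCommGroup M]
    [Module R M] (a : ι → M) (b : κ → M) (h : ι ⊕ κ →₀ R) :
    Finsupp.linearCombination R (Sum.elim a b) h =
      Finsupp.linearCombination R a (Finsupp.lcomapDomain (R := R) Sum.inl Sum.inl_injective h) +
      Finsupp.linearCombination R b (Finsupp.lcomapDomain (R := R) Sum.inr Sum.inr_injective h) := by
  have : Finsupp.linearCombination R (Sum.elim a b) =
      Finsupp.linearCombination R a ∘ₗ Finsupp.lcomapDomain (R := R) Sum.inl Sum.inl_injective +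
      Finsupp.linearCombination R b ∘ₗ Finsupp.lcomapDomain (R := R) Sum.inr Sum.inr_injective := by
    apply Finsupp.lhom_ext
    rintro (i | j) r
    · have h1 : Finsupp.comapDomain (Sum.inl : ι → ι ⊕ κ) (Finsupp.single (Sum.inl i) r)
          Sum.inl_injective.injOn = Finsupp.single i r := by
        ext x; simp
      have h2 : Finsupp.comapDomain (Sum.inr : κ → ι ⊕ κ) (Finsupp.single (Sum.inl i) r)
          Sum.inr_injective.injOn = 0 := by
        ext x; simp
      simp [Finsupp.lcomapDomain, h1, h2]
    · have h1 : Finsupp.comapDomain (Sum.inr : κ → ι ⊕ κ) (Finsupp.single (Sum.inr j) r)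
          Sum.inr_injective.injOn = Finsupp.single j r := by
        ext x; simp
      have h2 : Finsupp.comapDomain (Sum.inl : ι → ι ⊕ κ) (Finsupp.single (Sum.inr j) r)
          Sum.inl_injective.injOn = 0 := by
        ext x; simp
      simp [Finsupp.lcomapDomain, h1, h2]
  rw [this]; rfl

/-- The horseshoe lemma for linear resolutions. -/
theorem HasLinearSyzygies.of_exact {p : ℕ} {M' M M'' : Type (max u v)} [AddCommGroup M']
    [AddCommGroup M] [AddCommGroup M''] [Module (MvPolynomial σ K) M']
    [Module (MvPolynomial σ K) M] [Module (MvPolynomial σ K) M'']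
    (gr' : ℕ → AddSubgroup M') (gr : ℕ → AddSubgroup M) (gr'' : ℕ → AddSubgroup M'')
    (hsmul : ∀ k e (a : MvPolynomial σ K) x, a.IsHomogeneous k → x ∈ gr e → a • x ∈ gr (e + k))
    (α : M' →ₗ[MvPolynomial σ K] M) (β : M →ₗ[MvPolynomial σ K] M'')
    (hα : Function.Injective α) (hβ : Function.Surjective β) (hαβ : Function.Exact α β)
    (hgα : ∀ e x, α x ∈ gr e ↔ x ∈ gr' e) (hgβ : ∀ e, ∀ x ∈ gr e, β x ∈ gr'' e)
    (hgβ' : ∀ e, ∀ y ∈ gr'' e, ∃ x ∈ gr e, β x = y)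
    (h' : HasLinearSyzygies (σ := σ) (K := K) p M' gr')
    (h'' : HasLinearSyzygies (σ := σ) (K := K) p M'' gr'') :
    HasLinearSyzygies (σ := σ) (K := K) p M gr := by
  induction p generalizing M' M M'' with
  | zero =>
    have i1 : Subsingleton M' := h'
    have i2 : Subsingleton M'' := h''
    refine ⟨fun a b => sub_eq_zero.1 ?_⟩
    obtain ⟨c, hc⟩ := (hαβ (a - b)).1 (Subsingleton.elim _ _)
    rw [← hc, Subsingleton.elim c 0, map_zero]
  | succ p ih =>
    obtain ⟨ι, _, m', m0', ms', mg', hk'⟩ := h'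
    obtain ⟨κ, _, m'', m0'', ms'', mg'', hk''⟩ := h''
    -- Lift the generators of `M''` to degree `0` in `M`; with the images of those of `M'` they
    -- generate `M`.
    choose n hn0 hn using fun j => hgβ' 0 _ (m0'' j)
    have hβn : ∀ g : κ →₀ MvPolynomial σ K, β (Finsupp.linearCombination _ n g) =
        Finsupp.linearCombination _ m'' g := by
      intro g
      rw [← LinearMap.comp_apply, ← Finsupp.linearCombination_linear_comp]
      congr 2; funext j; exact hn j
    have hαm : ∀ g : ι →₀ MvPolynomial σ K, Finsupp.linearCombination _ (α ∘ m') g =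
        α (Finsupp.linearCombination _ m' g) := by
      intro g
      rw [Finsupp.linearCombination_linear_comp, LinearMap.comp_apply]
    have hgn : ∀ e (g : κ →₀ MvPolynomial σ K), (∀ i, (g i).IsHomogeneous e) →
        Finsupp.linearCombination _ n g ∈ gr e := by
      intro e g hg
      rw [Finsupp.linearCombination_apply]
      refine sum_mem fun j _ => ?_
      simpa using hsmul e 0 _ _ (hg j) (hn0 j)
    set m : ι ⊕ κ → M := Sum.elim (α ∘ m') n with hm
    have key : ∀ (f : ι →₀ MvPolynomial σ K) (g : κ →₀ MvPolynomial σ K),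
        Finsupp.linearCombination _ m (Finsupp.sumElim f g) =
          α (Finsupp.linearCombination _ m' f) + Finsupp.linearCombination _ n g := by
      intro f g
      rw [hm, linearCombination_sumElim_apply, hαm]
      congr 3 <;> ext <;> rfl
    refine ⟨ι ⊕ κ, inferInstance, m, ?_, ?_, ?_, ?_⟩
    · rintro (i | j)
      · exact (hgα 0 _).2 (m0' i)
      · exact hn0 j
    · intro x
      obtain ⟨g, hg⟩ := ms'' (β x)
      obtain ⟨y, hy⟩ := (hαβ (x - Finsupp.linearCombination _ n g)).1 (by
        rw [map_sub, hβn, hg, sub_self])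
      obtain ⟨f, rfl⟩ := ms' y
      refine ⟨Finsupp.sumElim f g, ?_⟩
      rw [key, hy]; abel
    · intro e x hx
      obtain ⟨g, hgh, hg⟩ := mg'' e _ (hgβ e x hx)
      obtain ⟨y, hy⟩ := (hαβ (x - Finsupp.linearCombination _ n g)).1 (by
        rw [map_sub, hβn, hg, sub_self])
      obtain ⟨f, hfh, rfl⟩ := mg' e y ((hgα e y).1 (by
        rw [hy]; exact sub_mem hx (hgn e g hgh)))
      refine ⟨Finsupp.sumElim f g, ?_, ?_⟩
      · rintro (i | j)
        · exact hfh i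
        · exact hgh j
      · rw [key, hy]; abel
    · have kα : ∀ f : LinearMap.ker (Finsupp.linearCombination (MvPolynomial σ K) m'),
          Finsupp.lmapDomain (MvPolynomial σ K) (MvPolynomial σ K) (Sum.inl : ι → ι ⊕ κ) f.1 ∈
            LinearMap.ker (Finsupp.linearCombination (MvPolynomial σ K) m) := by
        rintro ⟨f, hf⟩
        rw [LinearMap.mem_ker] at hf ⊢
        rw [Finsupp.lmapDomain_apply, Finsupp.linearCombination_mapDomain]
        change Finsupp.linearCombination _ (α ∘ m') f = 0
        rw [hαm, hf, map_zero]
      have kβ : ∀ f : LinearMap.ker (Finsupp.linearCombination (MvPolynomial σ K) m),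
          Finsupp.lcomapDomain (R := MvPolynomial σ K) (Sum.inr : κ → ι ⊕ κ) Sum.inr_injective
            f.1 ∈ LinearMap.ker (Finsupp.linearCombination (MvPolynomial σ K) m'') := by
        rintro ⟨f, hf⟩
        rw [LinearMap.mem_ker] at hf ⊢
        have := congrArg β hf
        rwa [hm, linearCombination_sumElim_apply, hαm, map_add, hαβ.apply_apply_eq_zero, hβn,
          zero_add, map_zero] at this
      -- The three syzygy modules again form a graded exact sequence. A syzygy `g` of `m''` lifts to
      -- `(-f, g)`, where `f` expresses the value of `g` on the lifts `n`, which lies in `M'`.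
      refine ih (syzygyGrading m') (syzygyGrading m) (syzygyGrading m'') ?_
        (LinearMap.codRestrict _ (Finsupp.lmapDomain _ _ Sum.inl ∘ₗ Submodule.subtype _) kα)
        (LinearMap.codRestrict _
          (Finsupp.lcomapDomain Sum.inr Sum.inr_injective ∘ₗ Submodule.subtype _) kβ)
        ?_ ?_ ?_ ?_ ?_ ?_ hk' hk''
      · intro k e a f ha hf i
        have := ha.mul (hf i)
        rwa [add_comm k, add_right_comm] at this
      · intro f g hfg
        exact Subtype.ext (Finsupp.mapDomain_injective Sum.inl_injective
          (congrArg Subtype.val hfg))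
      · rintro ⟨g, hg⟩
        rw [LinearMap.mem_ker] at hg
        obtain ⟨y, hy⟩ := (hαβ (Finsupp.linearCombination _ n g)).1 (by rw [hβn, hg])
        obtain ⟨f, rfl⟩ := ms' y
        refine ⟨⟨Finsupp.sumElim (-f) g, ?_⟩, ?_⟩
        · rw [LinearMap.mem_ker, key, map_neg, map_neg, hy, neg_add_cancel]
        · ext j; rfl
      · rintro ⟨h, hh⟩
        constructor
        · intro h0
          have h0' : ∀ j, h (Sum.inr j) = 0 := fun j => DFunLike.congr_fun
            (congrArg Subtype.val h0) j
          have hsplit : h = Finsupp.mapDomain Sum.inl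
              (Finsupp.comapDomain Sum.inl h Sum.inl_injective.injOn) := by
            ext1 (i | j)
            · rw [Finsupp.mapDomain_apply Sum.inl_injective]; rfl
            · rw [h0', Finsupp.mapDomain_of_notMem_range]; simp
          refine ⟨⟨Finsupp.comapDomain Sum.inl h Sum.inl_injective.injOn, ?_⟩,
            Subtype.ext hsplit.symm⟩
          rw [LinearMap.mem_ker] at hh ⊢
          rw [hsplit, Finsupp.linearCombination_mapDomain] at hh
          change Finsupp.linearCombination _ (α ∘ m') _ = 0 at hh
          rw [hαm] at hh
          exact hα (hh.trans (map_zero α).symm)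
        · rintro ⟨f, hf⟩
          rw [← hf]
          apply Subtype.ext
          ext1 j
          change Finsupp.mapDomain Sum.inl f.1 (Sum.inr j) = 0
          rw [Finsupp.mapDomain_of_notMem_range]; simp
      · rintro e ⟨f, hf⟩
        simp only [mem_syzygyGrading]
        constructor
        · intro h i
          have := h (Sum.inl i)
          change (Finsupp.mapDomain Sum.inl f (Sum.inl i)).IsHomogeneous _ at this
          rwa [Finsupp.mapDomain_apply Sum.inl_injective] at this
        · rintro h (i | j)
          · change (Finsupp.mapDomain Sum.inl f (Sum.inl i)).IsHomogeneous _
            rw [Finsupp.mapDomain_apply Sum.inl_injective]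
            exact h i
          · change (Finsupp.mapDomain Sum.inl f (Sum.inr j)).IsHomogeneous _
            rw [Finsupp.mapDomain_of_notMem_range]
            · exact isHomogeneous_zero _ _ _
            · simp
      · intro e f hf j
        exact hf (Sum.inr j)
      · rintro e ⟨g, hg⟩ hgh
        rw [LinearMap.mem_ker] at hg
        obtain ⟨y, hy⟩ := (hαβ (Finsupp.linearCombination _ n g)).1 (by rw [hβn, hg])
        obtain ⟨f, hfh, rfl⟩ := mg' (e + 1) y ((hgα _ y).1 (by rw [hy]; exact hgn _ g hgh))
        refine ⟨⟨Finsupp.sumElim (-f) g, ?_⟩, ?_, ?_⟩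
        · rw [LinearMap.mem_ker, key, map_neg, map_neg, hy, neg_add_cancel]
        · rintro (i | j)
          · exact (hfh i).neg
          · exact hgh j
        · ext j; rfl

theorem HasLinearSyzygies.of_linearEquiv {p : ℕ} {M N : Type (max u v)} [AddCommGroup M]
    [AddCommGroup N] [Module (MvPolynomial σ K) M] [Module (MvPolynomial σ K) N]
    (gr : ℕ → AddSubgroup M) (gr' : ℕ → AddSubgroup N)
    (hsmul : ∀ k e (a : MvPolynomial σ K) x, a.IsHomogeneous k → x ∈ gr e → a • x ∈ gr (e + k))
    (φ : M ≃ₗ[MvPolynomial σ K] N) (hφ : ∀ e x, φ x ∈ gr' e ↔ x ∈ gr e)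
    (h : HasLinearSyzygies (σ := σ) (K := K) p N gr') :
    HasLinearSyzygies (σ := σ) (K := K) p M gr := by
  refine .of_exact (M' := (⊥ : Submodule (MvPolynomial σ K) M)) ⊤ gr gr' hsmul
    (Submodule.subtype _) φ.toLinearMap (Submodule.subtype_injective _) φ.surjective ?_ ?_
    (fun e x hx => (hφ e x).2 hx)
    (fun e y hy => ⟨φ.symm y, (hφ e _).1 (by simpa using hy), by simp⟩)
    (.of_subsingleton _ _ _) h
  · intro y
    constructor
    · intro hy
      exact ⟨⟨y, by simpa using hy⟩, rfl⟩
    · rintro ⟨x, rfl⟩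
      rw [Subsingleton.elim x 0]; simp
  · intro e x
    rw [Subsingleton.elim x 0]
    exact ⟨fun _ => trivial, fun _ => by simp⟩

/-- A complex of free modules with entries of degree one, which resolves `M`. -/
structure LinearComplex (M : Type (max u v)) [AddCommGroup M] [Module (MvPolynomial σ K) M]
    (S : AddSubgroup M) where
  gen : ℕ → Type
  finite_gen : ∀ i, Finite (gen i)
  d : (i : ℕ) → (gen (i + 1) →₀ MvPolynomial σ K) →ₗ[MvPolynomial σ K]
    (gen i →₀ MvPolynomial σ K)
  aug : (gen 0 →₀ MvPolynomial σ K) →ₗ[MvPolynomial σ K] M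
  linear_d : ∀ i k j, (d i (Finsupp.single k 1) j).IsHomogeneous 1
  aug_mem : ∀ k, aug (Finsupp.single k 1) ∈ S
  aug_surjective : Function.Surjective aug
  exact_zero : Function.Exact (d 0) aug
  exact_succ : ∀ i, Function.Exact (d (i + 1)) (d i)
  finite_length : ∃ p : ℕ, ∀ i, p < i → IsEmpty (gen i)

/-- Splices the successive generating families: degree `0` in `syzygyGrading` means coordinates that
are linear forms, so every differential has linear entries. -/
theorem HasLinearSyzygies.nonempty_linearComplex {p : ℕ} {M : Type (max u v)} [AddCommGroup M]
    [Module (MvPolynomial σ K) M] {gr : ℕ → AddSubgroup M}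
    (h : HasLinearSyzygies (σ := σ) (K := K) p M gr) :
    Nonempty (LinearComplex (σ := σ) (K := K) M (gr 0)) := by
  induction p generalizing M with
  | zero =>
    have : Subsingleton M := h
    exact ⟨{ gen := fun _ => Empty
             finite_gen := fun _ => inferInstance
             d := fun _ => 0
             aug := 0
             linear_d := fun _ k => k.elim
             aug_mem := fun k => k.elim
             aug_surjective := fun _ => ⟨0, Subsingleton.elim _ _⟩
             exact_zero := fun y => ⟨fun _ => ⟨0, Subsingleton.elim _ _⟩, fun _ => rfl⟩
             exact_succ := fun _ y => ⟨fun _ => ⟨0, Subsingleton.elim _ _⟩, fun _ => rfl⟩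
             finite_length := ⟨0, fun _ _ => inferInstance⟩ }⟩
  | succ p ih =>
    obtain ⟨ι, hι, m, m0, ms, mg, hk⟩ := h
    obtain ⟨C⟩ := ih hk
    refine ⟨{ gen := fun | 0 => ι | i + 1 => C.gen i
              finite_gen := fun | 0 => hι | i + 1 => C.finite_gen i
              d := fun | 0 => Submodule.subtype _ ∘ₗ C.aug | i + 1 => C.d i
              aug := Finsupp.linearCombination _ m
              linear_d := fun | 0 => C.aug_mem | i + 1 => C.linear_d i
              aug_mem := fun k => ?_
              aug_surjective := ms
              exact_zero := fun y => ⟨fun hy => ?_, ?_⟩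
              exact_succ := fun | 0 => fun y => ?_ | i + 1 => C.exact_succ i
              finite_length := ?_ }⟩
    · simpa using m0 k
    · obtain ⟨z, hz⟩ := C.aug_surjective ⟨y, hy⟩
      exact ⟨z, congrArg Subtype.val hz⟩
    · rintro ⟨z, rfl⟩
      exact (C.aug z).2
    · rw [← C.exact_zero y]
      exact ⟨fun hy => Subtype.ext hy, fun hy => congrArg Subtype.val hy⟩
    · obtain ⟨p, hp⟩ := C.finite_length
      refine ⟨p + 1, fun i hi => ?_⟩
      obtain ⟨j, rfl⟩ : ∃ j, i = j + 1 := ⟨i - 1, by omega⟩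
      exact hp j (by omega)

/-- The elements of degree `d + e` of an ideal. -/
def idealGrading (I : Ideal (MvPolynomial σ K)) (d e : ℕ) : AddSubgroup I where
  carrier := {x | x.1.IsHomogeneous (d + e)}
  zero_mem' := isHomogeneous_zero _ _ _
  add_mem' hf hg := hf.add hg
  neg_mem' hf := hf.neg

theorem mem_idealGrading (I : Ideal (MvPolynomial σ K)) (d e : ℕ) (x : I) :
    x ∈ idealGrading I d e ↔ x.1.IsHomogeneous (d + e) := Iff.rfl

theorem smul_mem_idealGrading (I : Ideal (MvPolynomial σ K)) (d k e : ℕ) (a : MvPolynomial σ K)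
    (x : I) (ha : a.IsHomogeneous k) (hx : x ∈ idealGrading I d e) :
    a • x ∈ idealGrading I d (e + k) := by
  have := ha.mul hx
  rwa [add_comm k, add_assoc] at this

/-- Minimality is automatic, since a homogeneous entry of degree one has no constant term. -/
theorem HasLinearSyzygies.hasLinearResolution {p d : ℕ} {I : Ideal (MvPolynomial σ K)}
    (h : HasLinearSyzygies (σ := σ) (K := K) p I (idealGrading I d)) :
    HasLinearResolution I := by
  obtain ⟨C⟩ := h.nonempty_linearComplex
  refine ⟨d, { gen := C.gen
               finite_gen := C.finite_gen
               shift := fun i _ => (d : ℤ) + i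
               d := C.d
               aug := Submodule.subtype _ ∘ₗ C.aug
               graded_d := fun i k j _ => ⟨1, C.linear_d i k j, by push_cast; ring⟩
               graded_aug := fun k _ => ⟨d, C.aug_mem k, by simp⟩
               range_aug := ?_
               exact_zero := fun y => ?_
               exact_succ := C.exact_succ
               finite_length := C.finite_length }, ?_, fun _ _ => rfl⟩
  · rw [LinearMap.range_comp, LinearMap.range_eq_top.2 C.aug_surjective, Submodule.map_top,
      Submodule.range_subtype]
  · rw [← C.exact_zero y]
    exact ⟨fun hy => Subtype.ext hy, fun hy => congrArg Subtype.val hy⟩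
  · intro i k j
    exact (C.linear_d i k j).coeff_eq_zero (by simp)

end LinearResolutions

/-! ### Linear quotients and monomial ideals. -/

section LinearQuotients

variable {σ : Type u} {K : Type v} [Field K]

theorem homogeneousComponent_mul_of_isHomogeneous (f : MvPolynomial σ K) {m : MvPolynomial σ K}
    {d : ℕ} (hm : m.IsHomogeneous d) (e : ℕ) :
    homogeneousComponent (d + e) (f * m) = homogeneousComponent e f * m := by
  let := gradedAlgebra (σ := σ) (R := K)
  have h : ∀ (g : MvPolynomial σ K) (n : ℕ),
      (DirectSum.decompose (homogeneousSubmodule σ K) g n : MvPolynomial σ K) =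
        homogeneousComponent n g := decomposition.decompose'_apply
  rw [add_comm, ← h, ← h]
  exact DirectSum.coe_decompose_mul_add_of_right_mem (homogeneousSubmodule σ K) hm

theorem homogeneousComponent_mem_span_monomial (s : Set (σ →₀ ℕ)) (n : ℕ) {f : MvPolynomial σ K}
    (hf : f ∈ Ideal.span ((fun m => monomial m (1 : K)) '' s)) :
    homogeneousComponent n f ∈ Ideal.span ((fun m => monomial m (1 : K)) '' s) := by
  rw [mem_ideal_span_monomial_image] at hf ⊢
  intro m hm
  refine hf m ?_
  rw [mem_support_iff, coeff_homogeneousComponent] at hm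
  rw [mem_support_iff]
  intro h
  simp [h] at hm

/-- Horseshoe for `0 → I → I + (m) → (R/J)(-d) → 0` with `J = I : m`. The quotient is cyclic and its
syzygy module is `J`, so `J` must have linear syzygies with generators in degree `1`. -/
theorem HasLinearSyzygies.sup_span_singleton {p d : ℕ} {I J : Ideal (MvPolynomial σ K)}
    {m : MvPolynomial σ K} (hm : m.IsHomogeneous d)
    (hI : ∀ f ∈ I, ∀ n, homogeneousComponent n f ∈ I)
    (hJ : ∀ f, f * m ∈ I ↔ f ∈ J)
    (h : HasLinearSyzygies (σ := σ) (K := K) (p + 1) I (idealGrading I d))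
    (h' : HasLinearSyzygies (σ := σ) (K := K) p J (idealGrading J 1)) :
    HasLinearSyzygies (σ := σ) (K := K) (p + 1) (I ⊔ Ideal.span {m} : Ideal (MvPolynomial σ K))
      (idealGrading _ d) := by
  set I' := I ⊔ Ideal.span {m} with hI'
  have hmem : m ∈ I' := Ideal.mem_sup_right (Ideal.mem_span_singleton_self m)
  let α : I →ₗ[MvPolynomial σ K] I' := Submodule.inclusion (le_sup_left : I ≤ I')
  have hα : ∀ x : I', x ∈ LinearMap.range α ↔ x.1 ∈ I := by
    intro x
    constructor
    · rintro ⟨y, rfl⟩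
      exact y.2
    · intro hx
      exact ⟨⟨x.1, hx⟩, rfl⟩
  let β := (LinearMap.range α).mkQ
  let mm : Unit → (I' ⧸ LinearMap.range α) := fun _ => β ⟨m, hmem⟩
  have hlc : ∀ f : Unit →₀ MvPolynomial σ K, Finsupp.linearCombination _ mm f =
      β ⟨f () * m, I'.mul_mem_left _ hmem⟩ := by
    intro f
    rw [Finsupp.linearCombination_unique]
    rfl
  have hβ0 : ∀ x, β x = 0 ↔ x.1 ∈ I := fun x => by
    rw [← hα]; exact Submodule.Quotient.mk_eq_zero _
  have hβ : ∀ x y, β x = β y ↔ x.1 - y.1 ∈ I := fun x y => by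
    rw [← sub_eq_zero, ← map_sub, hβ0]; rfl
  refine .of_exact (idealGrading I d) _ (fun e => (idealGrading I' d e).map β.toAddMonoidHom)
    (fun k e a x ha hx => smul_mem_idealGrading _ _ _ _ _ _ ha hx) α β
    (Submodule.inclusion_injective _) (Submodule.mkQ_surjective _)
    (LinearMap.exact_iff.2 (Submodule.ker_mkQ _)) (fun e x => Iff.rfl)
    (fun e x hx => ⟨x, hx, rfl⟩) (fun e y hy => hy) h ?_
  refine ⟨Unit, inferInstance, mm, fun _ => ⟨_, by simpa [mem_idealGrading] using hm, rfl⟩,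
    ?_, ?_, ?_⟩
  · intro y
    obtain ⟨⟨x, hx⟩, rfl⟩ := Submodule.mkQ_surjective _ y
    obtain ⟨i, hi, z, hz, rfl⟩ := Submodule.mem_sup.1 hx
    obtain ⟨f, rfl⟩ := Ideal.mem_span_singleton'.1 hz
    refine ⟨Finsupp.single () f, ?_⟩
    rw [hlc]
    refine (hβ _ _).2 ?_
    simpa using I.neg_mem hi
  · rintro e _ ⟨⟨x, hx⟩, hxe, rfl⟩
    obtain ⟨i, hi, z, hz, rfl⟩ := Submodule.mem_sup.1 hx
    obtain ⟨f, rfl⟩ := Ideal.mem_span_singleton'.1 hz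
    refine ⟨Finsupp.single () (homogeneousComponent e f), ?_, ?_⟩
    · intro _
      simpa using homogeneousComponent_isHomogeneous e f
    · rw [hlc]
      refine (hβ _ _).2 ?_
      have h1 := homogeneousComponent_eq_self ((mem_idealGrading _ _ _ _).1 hxe)
      simp only [map_add, homogeneousComponent_mul_of_isHomogeneous f hm] at h1
      simp only [Finsupp.single_eq_same]
      rw [← h1]
      simpa using I.neg_mem (hI i hi _)
  · refine .of_linearEquiv _ (idealGrading J 1)
      (fun k e a f ha hf i => by
        have := ha.mul (hf i)
        rwa [add_comm k, add_right_comm] at this)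
      (LinearEquiv.ofSubmodules (Finsupp.uniqueLinearEquiv _ _ ()) _ J ?_) ?_ h'
    · ext f
      simp only [Submodule.mem_map, LinearMap.mem_ker, hlc, hβ0, hJ]
      constructor
      · rintro ⟨g, hg, rfl⟩
        exact hg
      · intro hf
        exact ⟨Finsupp.single () f, by simpa using hf, by
          simp [Finsupp.uniqueLinearEquiv]⟩
    · intro e f
      rw [mem_idealGrading, mem_syzygyGrading, add_comm 1 e]
      exact ⟨fun h _ => h, fun h => h ()⟩

theorem span_monomial_insert (a : σ →₀ ℕ) (s : Set (σ →₀ ℕ)) :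
    Ideal.span ((fun m => monomial m (1 : K)) '' insert a s) =
      Ideal.span ((fun m => monomial m (1 : K)) '' s) ⊔ Ideal.span {monomial a (1 : K)} := by
  rw [Set.image_insert_eq, Ideal.span_insert, sup_comm]

theorem exists_hasLinearSyzygies_span_X (A : Finset σ) :
    ∃ p, HasLinearSyzygies (σ := σ) (K := K) p
      (Ideal.span (X '' (A : Set σ)) : Ideal (MvPolynomial σ K)) (idealGrading _ 1) := by
  classical
  induction A using Finset.induction_on with
  | empty =>
    refine ⟨0, ?_⟩
    rw [Finset.coe_empty, Set.image_empty, Ideal.span_empty]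
    exact .of_subsingleton _ _ _
  | insert a A ha ih =>
    obtain ⟨p, hp⟩ := ih
    refine ⟨p + 1, ?_⟩
    rw [Finset.coe_insert, Set.image_insert_eq, Ideal.span_insert, sup_comm]
    -- The colon of an ideal of variables by a further variable is the same ideal, so `hp` serves
    -- twice.
    refine .sup_span_singleton (isHomogeneous_X _ a) ?_ ?_ hp.succ hp
    · intro f hf n
      rw [mem_ideal_span_X_image] at hf ⊢
      intro m hm
      refine hf m ?_
      rw [mem_support_iff, coeff_homogeneousComponent] at hm
      rw [mem_support_iff]
      intro h
      simp [h] at hm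
    · intro f
      simp only [mem_ideal_span_X_image, support_mul_X, Finset.mem_map, addRightEmbedding_apply,
        forall_exists_index, and_imp, forall_apply_eq_imp_iff₂]
      refine forall₂_congr fun m _ => exists_congr fun i => and_congr_right fun hi => ?_
      have : i ≠ a := fun h => ha (h ▸ hi)
      simp [this.symm]

/-- A set of monomials of degree `d` with the weak exchange property generates an ideal with
linear quotients, in decreasing lexicographic order. -/
theorem exists_hasLinearSyzygies_of_weak_exchange [LinearOrder σ] [Finite σ]
    (s : Finset (Lex (σ →₀ ℕ))) (d : ℕ)
    (hd : ∀ m ∈ s, (ofLex m).degree = d)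
    (hs : ∀ f ∈ s, ∀ g ∈ s, ∀ t, (∀ i < t, ofLex f i = ofLex g i) → ofLex g t < ofLex f t →
      ∃ l, t < l ∧ 0 < ofLex g l ∧
        toLex (ofLex g - Finsupp.single l 1 + Finsupp.single t 1) ∈ s) :
    ∃ p, HasLinearSyzygies (σ := σ) (K := K) p
      (Ideal.span ((fun m => monomial m (1 : K)) '' {m | toLex m ∈ s}) :
        Ideal (MvPolynomial σ K)) (idealGrading _ d) := by
  classical
  induction s using Finset.induction_on_min with
  | empty =>
    refine ⟨0, ?_⟩
    have : {m : σ →₀ ℕ | toLex m ∈ (∅ : Finset (Lex (σ →₀ ℕ)))} = ∅ := by ext; simp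
    rw [this, Set.image_empty, Ideal.span_empty]
    exact .of_subsingleton _ _ _
  | insert a s ha ih =>
    -- An exchange raises the monomial lexicographically. Hence it never produces the smallest
    -- element `a`, and the exchange property passes to `s`.
    have hlt : ∀ (g : Lex (σ →₀ ℕ)) (t l : σ), t < l → 0 < ofLex g l →
        g < toLex (ofLex g - Finsupp.single l 1 + Finsupp.single t 1) := by
      intro g t l htl hl
      refine Finsupp.Lex.lt_iff.2 ⟨t, fun j hj => ?_, ?_⟩
      · have h1 : j ≠ t := hj.ne
        have h2 : j ≠ l := (hj.trans htl).ne
        change ofLex g j = (ofLex g - Finsupp.single l 1 + Finsupp.single t 1 : σ →₀ ℕ) j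
        simp [h1.symm, h2.symm]
      · change ofLex g t < (ofLex g - Finsupp.single l 1 + Finsupp.single t 1 : σ →₀ ℕ) t
        simp [htl.ne']
    obtain ⟨p, hp⟩ := ih (fun m hm => hd m (Finset.mem_insert_of_mem hm)) (by
      intro f hf g hg t h1 h2
      obtain ⟨l, h3, h4, h5⟩ := hs f (Finset.mem_insert_of_mem hf) g (Finset.mem_insert_of_mem hg)
        t h1 h2
      refine ⟨l, h3, h4, (Finset.mem_insert.1 h5).resolve_left fun h => ?_⟩
      have h6 := hlt g t l h3 h4
      rw [h] at h6
      exact lt_asymm h6 (ha g hg))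
    -- The variables `x_t` with `t ∈ A` generate the colon ideal of `s` by `a`.
    let A : Set σ := {t | ∃ l, t < l ∧ 0 < ofLex a l ∧
      toLex (ofLex a - Finsupp.single l 1 + Finsupp.single t 1) ∈ s}
    obtain ⟨p', hp'⟩ := exists_hasLinearSyzygies_span_X (K := K) A.toFinite.toFinset
    rw [Set.Finite.coe_toFinset] at hp'
    refine ⟨max p p' + 1, ?_⟩
    have hset : {m : σ →₀ ℕ | toLex m ∈ insert a s} = insert (ofLex a) {m | toLex m ∈ s} := by
      ext m
      simp only [Set.mem_ofPred_eq, Finset.mem_insert, Set.mem_insert_iff]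
      exact Iff.rfl
    rw [hset, span_monomial_insert]
    refine .sup_span_singleton
      (isHomogeneous_monomial _ (hd a (Finset.mem_insert_self a s)))
      (fun f hf n => homogeneousComponent_mem_span_monomial _ _ hf) ?_
      (hp.mono (by omega)) (hp'.mono (le_max_right _ _))
    intro f
    rw [mem_ideal_span_X_image, mem_ideal_span_monomial_image]
    constructor
    · intro h m hm
      obtain ⟨b, hb, hle⟩ := h (m + ofLex a) (by
        rw [mem_support_iff] at hm ⊢
        rwa [coeff_mul_monomial, mul_one])
      -- At the first place `t` where `b` differs from `a`, `b` is larger. The exchange puts `t`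
      -- into `A`, and `b ≤ m + a` forces `x_t` to divide `m`.
      obtain ⟨t, ht1, ht2⟩ := Finsupp.Lex.lt_iff.1 (ha _ hb)
      obtain ⟨l, h3, h4, h5⟩ := hs _ (Finset.mem_insert_of_mem hb) a (Finset.mem_insert_self a s) t
        (fun i hi => (ht1 i hi).symm) ht2
      refine ⟨t, ⟨l, h3, h4, (Finset.mem_insert.1 h5).resolve_left fun h => ?_⟩, ?_⟩
      · have h6 := hlt a t l h3 h4
        rw [h] at h6
        exact lt_irrefl _ h6
      · have h7 : b t ≤ m t + ofLex a t := hle t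
        have h8 : ofLex a t < b t := ht2
        omega
    · intro h m hm
      have hm' : ∃ m', m = m' + ofLex a ∧ m' ∈ f.support := by
        rw [mem_support_iff, coeff_mul_monomial'] at hm
        split_ifs at hm with hle
        · exact ⟨m - ofLex a, (tsub_add_cancel_of_le hle).symm, by
            rw [mem_support_iff]; simpa using hm⟩
        · exact absurd rfl hm
      obtain ⟨m', rfl, hm'⟩ := hm'
      obtain ⟨t, ⟨l, h1, h2, h3⟩, ht⟩ := h m' hm'
      refine ⟨_, h3, fun i => ?_⟩
      change (ofLex a - Finsupp.single l 1 + Finsupp.single t 1 : σ →₀ ℕ) i ≤ (m' + ofLex a) i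
      simp only [Finsupp.coe_add, Finsupp.coe_tsub, Pi.add_apply, Pi.sub_apply,
        Finsupp.single_apply]
      split_ifs <;> subst_vars <;> omega

/-- Membership of a monomial in a monomial ideal. -/
theorem monomial_mem_span_monomial_iff (s : Set (σ →₀ ℕ)) (m : σ →₀ ℕ) :
    monomial m (1 : K) ∈ Ideal.span ((fun m => monomial m (1 : K)) '' s) ↔ ∃ a ∈ s, a ≤ m := by
  classical
  rw [mem_ideal_span_monomial_image]
  simp [support_monomial]

/-- Distinct monomials of equal degree do not divide each other. -/
theorem minimalMonomials_span_monomial {s : Set (σ →₀ ℕ)} {d : ℕ} (hs : ∀ m ∈ s, m.degree = d) :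
    minimalMonomials (Ideal.span ((fun m => monomial m (1 : K)) '' s)) = s := by
  have hle : ∀ a ∈ s, ∀ b ∈ s, a ≤ b → a = b := by
    intro a ha b hb hab
    obtain ⟨c, rfl⟩ := exists_add_of_le hab
    have h := hs _ hb
    rw [map_add, hs a ha] at h
    have : c = 0 := (Finsupp.degree_eq_zero_iff c).1 (by omega)
    rw [this, add_zero]
  ext m
  simp only [minimalMonomials, monomial_mem_span_monomial_iff, Set.mem_ofPred_eq]
  constructor
  · rintro ⟨⟨a, ha, ham⟩, hmin⟩
    have := le_antisymm ham (hmin ⟨a, ha, le_rfl⟩ ham)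
    rwa [← this]
  · intro hm
    refine ⟨⟨m, hm, le_rfl⟩, ?_⟩
    rintro b ⟨a, ha, hab⟩ hbm
    rw [← hle a ha m hm (hab.trans hbm)]
    exact hab

theorem isEquigeneratedMonomialIdeal_span_monomial {s : Set (σ →₀ ℕ)} {d : ℕ}
    (hs : ∀ m ∈ s, m.degree = d) :
    IsEquigeneratedMonomialIdeal (Ideal.span ((fun m => monomial m (1 : K)) '' s)) := by
  rw [IsEquigeneratedMonomialIdeal, minimalMonomials_span_monomial hs]
  exact ⟨rfl, d, hs⟩

end LinearQuotients

/-! ### Sums of squarefree exponent vectors and their polytope. -/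

section SquarefreeMonomials

variable {V : Type u}

/-- The exponent vector of the squarefree monomial `∏_{x ∈ S} x`. -/
noncomputable def indicatorExponent (S : Finset V) : V →₀ ℕ := ∑ x ∈ S, Finsupp.single x 1

theorem indicatorExponent_apply [DecidableEq V] (S : Finset V) (v : V) :
    indicatorExponent S v = if v ∈ S then 1 else 0 := by
  simp [indicatorExponent, Finsupp.finsetSum_apply, Finsupp.single_apply]

theorem degree_indicatorExponent (S : Finset V) : (indicatorExponent S).degree = S.card := by
  simp [indicatorExponent, map_sum]

theorem sum_indicatorExponent [DecidableEq V] (S H : Finset V) :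
    ∑ x ∈ H, indicatorExponent S x = (S ∩ H).card := by
  simp [indicatorExponent_apply, Finset.sum_ite_mem, Finset.inter_comm]

theorem indicatorExponent_insert_erase [DecidableEq V] {S : Finset V} {a b : V} (ha : a ∈ S)
    (hb : b ∉ S) : indicatorExponent (insert b (S.erase a)) + Finsupp.single a 1 =
      indicatorExponent S + Finsupp.single b 1 := by
  have hab : a ≠ b := fun h => hb (h ▸ ha)
  ext x
  simp only [Finsupp.add_apply, indicatorExponent_apply, Finset.mem_insert, Finset.mem_erase,
    Finsupp.single_apply]
  by_cases h1 : x = a <;> by_cases h2 : x = b <;> simp_all [eq_comm]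

theorem card_insert_erase_of_mem [DecidableEq V] {S : Finset V} {a b : V} (ha : a ∈ S)
    (hb : b ∉ S) : (insert b (S.erase a)).card = S.card := by
  rw [Finset.card_insert_of_notMem (fun h => hb (Finset.mem_of_mem_erase h)),
    Finset.card_erase_add_one ha]

theorem prod_X_eq_monomial_indicatorExponent (K : Type v) [Field K] (S : Finset V) :
    ∏ x ∈ S, (X x : MvPolynomial V K) = monomial (indicatorExponent S) 1 := by
  rw [indicatorExponent, monomial_sum_one]; rfl

/-- The sums of `q` exponent vectors of sets of size `k` that are not in the family `Bad`. -/
def goodSums (Bad : Finset V → Prop) (k q : ℕ) : Set (V →₀ ℕ) :=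
  {m | ∃ s : Multiset (Finset V), s.card = q ∧ (∀ S ∈ s, S.card = k ∧ ¬ Bad S) ∧
    (s.map indicatorExponent).sum = m}

theorem goodSums_zero (Bad : Finset V → Prop) (k : ℕ) : goodSums Bad k 0 = {0} := by
  ext m
  constructor
  · rintro ⟨s, hs, -, rfl⟩
    rw [Multiset.card_eq_zero.1 hs]; simp
  · rintro rfl
    exact ⟨0, rfl, by simp, by simp⟩

theorem goodSums_one (Bad : Finset V → Prop) (k : ℕ) :
    goodSums Bad k 1 = indicatorExponent '' {S | S.card = k ∧ ¬ Bad S} := by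
  ext m
  constructor
  · rintro ⟨s, hs, h, rfl⟩
    obtain ⟨S, rfl⟩ := Multiset.card_eq_one.1 hs
    exact ⟨S, h S (by simp), by simp⟩
  · rintro ⟨S, hS, rfl⟩
    exact ⟨{S}, by simp, by simpa using hS, by simp⟩

theorem mem_goodSums_succ {Bad : Finset V → Prop} {k q : ℕ} {m : V →₀ ℕ} :
    m ∈ goodSums Bad k (q + 1) ↔
      ∃ a ∈ goodSums Bad k q, ∃ S : Finset V, (S.card = k ∧ ¬ Bad S) ∧
        a + indicatorExponent S = m := by
  constructor
  · rintro ⟨s, hs, h, rfl⟩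
    obtain ⟨S, t, rfl⟩ := Multiset.card_pos_iff_exists_mem.1 (by omega : 0 < s.card) |>.imp
      fun S hS => Multiset.exists_cons_of_mem hS
    refine ⟨_, ⟨t, by simpa using hs, fun S' hS' => h S' (Multiset.mem_cons_of_mem hS'), rfl⟩, S,
      h S (Multiset.mem_cons_self _ _), ?_⟩
    rw [Multiset.map_cons, Multiset.sum_cons, add_comm]
  · rintro ⟨_, ⟨s, hs, h, rfl⟩, S, hS, rfl⟩
    refine ⟨S ::ₘ s, by simp [hs], ?_, by rw [Multiset.map_cons, Multiset.sum_cons, add_comm]⟩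
    intro S' hS'
    rcases Multiset.mem_cons.1 hS' with rfl | h'
    exacts [hS, h _ h']

theorem span_goodSums_pow (K : Type v) [Field K] (Bad : Finset V → Prop) (k q : ℕ) :
    (Ideal.span ((fun m => monomial m (1 : K)) '' goodSums Bad k 1)) ^ q =
      Ideal.span ((fun m => monomial m (1 : K)) '' goodSums Bad k q) := by
  induction q with
  | zero =>
    rw [pow_zero, goodSums_zero, Set.image_singleton, Ideal.one_eq_top, eq_comm,
      Ideal.eq_top_iff_one]
    exact Ideal.subset_span rfl
  | succ q ih =>
    rw [pow_succ, ih, Ideal.span_mul_span']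
    congr 1
    ext f
    constructor
    · rintro ⟨_, ⟨a, ha, rfl⟩, _, ⟨b, hb, rfl⟩, rfl⟩
      rw [goodSums_one] at hb
      obtain ⟨S, hS, rfl⟩ := hb
      exact ⟨a + indicatorExponent S, mem_goodSums_succ.2 ⟨a, ha, S, hS, rfl⟩, by
        simp [monomial_mul]⟩
    · rintro ⟨m, hm, rfl⟩
      obtain ⟨a, ha, S, hS, rfl⟩ := mem_goodSums_succ.1 hm
      refine ⟨_, ⟨a, ha, rfl⟩, _, ⟨indicatorExponent S, ?_, rfl⟩, by simp [monomial_mul]⟩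
      rw [goodSums_one]
      exact ⟨S, hS, rfl⟩

/-- The exponent vectors of degree `q k` which satisfy the inequalities of the `q`-fold sums of
sets of size `k` not in the family `Bad`. -/
def boundedExponents (Bad : Finset V → Prop) (k q : ℕ) : Set (V →₀ ℕ) :=
  {m | (∀ i, m i ≤ q) ∧ m.degree = q * k ∧ ∀ H, Bad H → ∑ x ∈ H, m x ≤ q * (k - 1)}

/-- A good set of size `k` differs from `H`, so it contributes at most `k - 1` to the sum over `H`.
-/
theorem goodSums_subset_boundedExponents {Bad : Finset V → Prop} {k : ℕ}
    (hcard : ∀ H, Bad H → H.card = k) (q : ℕ) :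
    goodSums Bad k q ⊆ boundedExponents Bad k q := by
  classical
  induction q with
  | zero =>
    rw [goodSums_zero]
    rintro _ rfl
    simp [boundedExponents]
  | succ q ih =>
    intro m hm
    obtain ⟨a, ha, S, ⟨hSk, hS⟩, rfl⟩ := mem_goodSums_succ.1 hm
    obtain ⟨h1, h2, h3⟩ := ih ha
    refine ⟨fun i => ?_, ?_, fun H hH => ?_⟩
    · rw [Finsupp.add_apply, indicatorExponent_apply]
      have := h1 i
      split_ifs <;> omega
    · rw [map_add, degree_indicatorExponent, h2, hSk, add_mul, one_mul]
    · simp only [Finsupp.add_apply, Finset.sum_add_distrib, sum_indicatorExponent]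
      have h4 : (S ∩ H).card ≤ k - 1 := by
        by_contra hlt
        have h5 : S ∩ H = S := Finset.eq_of_subset_of_card_le Finset.inter_subset_left (by omega)
        have h6 : S = H := Finset.eq_of_subset_of_card_le (Finset.inter_eq_left.1 h5)
          (by rw [hSk, hcard H hH])
        exact hS (h6 ▸ hH)
      have := h3 H hH
      rw [add_mul, one_mul]
      omega

/-- Every exponent vector of degree `q k` with entries at most `q` is a sum of `q` vectors of
sets of size `k`. -/
theorem exists_multiset_sum_indicatorExponent [Finite V] (k q : ℕ) (m : V →₀ ℕ)
    (hm : ∀ i, m i ≤ q) (hdeg : m.degree = q * k) :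
    ∃ s : Multiset (Finset V), s.card = q ∧ (∀ S ∈ s, S.card = k) ∧
      (s.map indicatorExponent).sum = m := by
  classical
  have := Fintype.ofFinite V
  induction q generalizing m with
  | zero =>
    refine ⟨0, rfl, by simp, ?_⟩
    ext i
    have := hm i
    simp only [Multiset.map_zero, Multiset.sum_zero, Finsupp.coe_zero, Pi.zero_apply]
    omega
  | succ q ih =>
    rw [Finsupp.degree_eq_sum] at hdeg
    have h1 : (Finset.univ.filter fun i => m i = q + 1).card ≤ k := by
      have : (Finset.univ.filter fun i => m i = q + 1).card * (q + 1) ≤ ∑ i, m i := by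
        rw [← smul_eq_mul, ← Finset.sum_const]
        refine (Finset.sum_le_sum fun i hi => ?_).trans
          (Finset.sum_le_sum_of_subset (Finset.filter_subset (fun i => m i = q + 1) _))
        exact (Finset.mem_filter.1 hi).2.ge
      rw [hdeg, mul_comm] at this
      exact Nat.le_of_mul_le_mul_left this (Nat.succ_pos q)
    have h2 : k ≤ m.support.card := by
      have : ∑ i, m i ≤ m.support.card * (q + 1) := by
        rw [← smul_eq_mul, ← Finset.sum_const]
        rw [← Finset.sum_subset (Finset.subset_univ m.support) (fun i _ hi => by simpa using hi)]
        exact Finset.sum_le_sum fun i _ => hm i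
      rw [hdeg, mul_comm m.support.card] at this
      exact Nat.le_of_mul_le_mul_left this (Nat.succ_pos q)
    -- `S` contains every coordinate equal to `q + 1`, so the remainder is bounded by `q`, and lies
    -- in the support, so it can be subtracted.
    obtain ⟨S, hS1, hS2, hS3⟩ := Finset.exists_subsuperset_card_eq
      (s := Finset.univ.filter fun i => m i = q + 1) (t := m.support)
      (fun i hi => by simp [(Finset.mem_filter.1 hi).2]) h1 h2
    have hle : indicatorExponent S ≤ m := by
      intro i
      rw [indicatorExponent_apply]
      split_ifs with hi
      · exact Nat.one_le_iff_ne_zero.2 (Finsupp.mem_support_iff.1 (hS2 hi))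
      · exact Nat.zero_le _
    obtain ⟨m', rfl⟩ := exists_add_of_le hle
    obtain ⟨s, hs1, hs2, rfl⟩ := ih m' (fun i => by
      have h3 := hm i
      by_cases hi : i ∈ S
      · rw [Finsupp.add_apply, indicatorExponent_apply, if_pos hi] at h3
        omega
      · by_contra h4
        refine hi (hS1 (Finset.mem_filter.2 ⟨Finset.mem_univ _, ?_⟩))
        rw [Finsupp.add_apply, indicatorExponent_apply, if_neg hi] at h3 ⊢
        omega) (by
      rw [← Finsupp.degree_eq_sum, map_add, degree_indicatorExponent, hS3, add_mul] at hdeg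
      omega)
    refine ⟨S ::ₘ s, by simp [hs1], ?_, by simp⟩
    intro S' hS'
    rcases Multiset.mem_cons.1 hS' with rfl | h'
    exacts [hS3, hs2 _ h']

theorem sum_multiset_indicatorExponent [DecidableEq V] (s : Multiset (Finset V)) (H : Finset V) :
    ∑ x ∈ H, (s.map indicatorExponent).sum x = (s.map fun S => (S ∩ H).card).sum := by
  induction s using Multiset.induction_on with
  | empty => simp
  | cons S s ih => simp [Finset.sum_add_distrib, sum_indicatorExponent, ih]

/-- Start from any decomposition into sets of size `k`; each swap keeps the sum and lowers the
number of bad summands. -/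
theorem boundedExponents_subset_goodSums [Finite V] [DecidableEq V] {Bad : Finset V → Prop}
    {k : ℕ} (hk : 1 ≤ k) (hcard : ∀ H, Bad H → H.card = k)
    (hswap : ∀ H S : Finset V, Bad H → S.card = k → (S ∩ H).card + 2 ≤ k →
      ∃ a ∈ H, a ∉ S ∧ ∃ b ∈ S, b ∉ H ∧ ¬ Bad (insert b (H.erase a)) ∧
        ¬ Bad (insert a (S.erase b))) (q : ℕ) :
    boundedExponents Bad k q ⊆ goodSums Bad k q := by
  classical
  rintro m ⟨hm1, hm2, hm3⟩
  obtain ⟨s, hs1, hs2, hs3⟩ := exists_multiset_sum_indicatorExponent k q m hm1 hm2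
  clear hm1 hm2
  induction hn : s.countP Bad using Nat.strong_induction_on generalizing s with
  | _ n ih =>
    subst hn
    by_cases hgood : ∀ S ∈ s, ¬ Bad S
    · exact ⟨s, hs1, fun S hS => ⟨hs2 S hS, hgood S hS⟩, hs3⟩
    push Not at hgood
    obtain ⟨H, hHs, hH⟩ := hgood
    obtain ⟨t, rfl⟩ := Multiset.exists_cons_of_mem hHs
    -- Otherwise the sum over `H` is at least `k + (q - 1) (k - 1)`, exceeding `q (k - 1)`.
    have hex : ∃ S ∈ t, (S ∩ H).card + 2 ≤ k := by
      by_contra hcon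
      push Not at hcon
      have h1 := hm3 H hH
      rw [← hs3, sum_multiset_indicatorExponent, Multiset.map_cons, Multiset.sum_cons,
        Finset.inter_self, hcard H hH] at h1
      have h2 : t.card * (k - 1) ≤ (t.map fun S => (S ∩ H).card).sum := by
        have := Multiset.card_nsmul_le_sum (s := t.map fun S => (S ∩ H).card) (a := k - 1) (by
          intro x hx
          obtain ⟨S, hS, rfl⟩ := Multiset.mem_map.1 hx
          have := hcon S hS
          omega)
        simpa using this
      rw [Multiset.card_cons] at hs1
      rw [← hs1, add_mul] at h1
      omega
    obtain ⟨S, hS, hSH⟩ := hex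
    obtain ⟨t, rfl⟩ := Multiset.exists_cons_of_mem hS
    have hSk := hs2 S (by simp)
    obtain ⟨a, haH, haS, b, hbS, hbH, h1, h2⟩ := hswap H S hH hSk hSH
    refine ih _ ?_ (insert b (H.erase a) ::ₘ insert a (S.erase b) ::ₘ t) ?_ ?_ ?_ rfl
    · rw [Multiset.countP_cons_of_neg _ h1, Multiset.countP_cons_of_neg _ h2,
        Multiset.countP_cons_of_pos _ hH]
      exact Nat.lt_succ_of_le (Multiset.countP_le_of_le _ (Multiset.le_cons_self _ _))
    · simpa using hs1
    · intro S' hS'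
      rw [Multiset.mem_cons, Multiset.mem_cons] at hS'
      rcases hS' with rfl | rfl | h
      · rw [card_insert_erase_of_mem haH hbH, hcard H hH]
      · rw [card_insert_erase_of_mem hbS haS, hSk]
      · exact hs2 _ (by simp [h])
    · rw [← hs3]
      simp only [Multiset.map_cons, Multiset.sum_cons]
      have e1 := indicatorExponent_insert_erase haH hbH
      have e2 := indicatorExponent_insert_erase hbS haS
      rw [← add_assoc, ← add_assoc]
      congr 1
      refine add_right_cancel (b := Finsupp.single a 1 + Finsupp.single b 1) ?_
      calc _ = (indicatorExponent (insert b (H.erase a)) + Finsupp.single a 1) +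
            (indicatorExponent (insert a (S.erase b)) + Finsupp.single b 1) := by abel
        _ = _ := by rw [e1, e2]; abel

/-- The weak exchange property of `boundedExponents`, provided that for each variable there is
a best tight constraint. -/
theorem boundedExponents_weak_exchange [Finite V] [LinearOrder V] {Bad : Finset V → Prop}
    {k q : ℕ} {f g : V →₀ ℕ} (hf : f ∈ boundedExponents Bad k q)
    (hg : g ∈ boundedExponents Bad k q) {t : V} (hlt : ∀ i < t, f i = g i) (ht : g t < f t)
    (htight : (∀ H, Bad H → t ∈ H → ∑ x ∈ H, g x ≠ q * (k - 1)) ∨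
      ∃ H₀, Bad H₀ ∧ t ∈ H₀ ∧ ∑ x ∈ H₀, g x = q * (k - 1) ∧
        ∀ H, Bad H → t ∈ H → ∑ x ∈ H, g x = q * (k - 1) → ∀ l ∈ H₀, t < l → l ∈ H) :
    ∃ l, t < l ∧ 0 < g l ∧
      g - Finsupp.single l 1 + Finsupp.single t 1 ∈ boundedExponents Bad k q := by
  classical
  have := Fintype.ofFinite V
  -- The surplus of `f` at `t` must be compensated in `H`, and this can only happen after `t`.
  have step : ∀ H : Finset V, t ∈ H → ∑ x ∈ H, f x ≤ ∑ x ∈ H, g x →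
      ∃ l ∈ H, t < l ∧ f l < g l := by
    intro H htH hle
    by_contra hcon
    push Not at hcon
    refine absurd hle (not_le.2 (Finset.sum_lt_sum (fun i hi => ?_) ⟨t, htH, ht⟩))
    rcases lt_trichotomy i t with h | rfl | h
    · exact (hlt i h).ge
    · exact ht.le
    · exact hcon i hi h
  have hdeg : ∑ x, f x = ∑ x, g x := by
    rw [← Finsupp.degree_eq_sum, ← Finsupp.degree_eq_sum, hf.2.1, hg.2.1]
  obtain ⟨l, htl, hl, hH⟩ : ∃ l, t < l ∧ 0 < g l ∧
      ∀ H, Bad H → t ∈ H → ∑ x ∈ H, g x = q * (k - 1) → l ∈ H := by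
    rcases htight with h | ⟨H₀, h1, h2, h3, h4⟩
    · obtain ⟨l, -, h5, h6⟩ := step Finset.univ (Finset.mem_univ t) hdeg.le
      exact ⟨l, h5, by omega, fun H hH htH he => absurd he (h H hH htH)⟩
    · obtain ⟨l, h5, h6, h7⟩ := step H₀ h2 ((hf.2.2 H₀ h1).trans h3.ge)
      exact ⟨l, h6, by omega, fun H hH htH he => h4 H hH htH he l h5 h6⟩
  refine ⟨l, htl, hl, ?_⟩
  have hle : Finsupp.single l 1 ≤ g := by
    rw [Finsupp.single_le_iff]; exact hl
  obtain ⟨g', rfl⟩ := exists_add_of_le hle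
  rw [add_tsub_cancel_left]
  obtain ⟨hg1, hg2, hg3⟩ := hg
  refine ⟨fun i => ?_, ?_, fun H hHb => ?_⟩
  · have h1 := hg1 i
    have h2 := hf.1 t
    rw [Finsupp.add_apply, Finsupp.single_apply] at *
    split_ifs at * <;> subst_vars <;> omega
  · rw [← hg2]; simp [add_comm]
  · have h1 := hg3 H hHb
    have h2 := hH H hHb
    simp only [Finsupp.add_apply, Finset.sum_add_distrib, Finsupp.single_apply,
      Finset.sum_ite_eq] at *
    split_ifs at * with h3 h4 <;> grind

end SquarefreeMonomials

/-! ### Stars in trees, and trees of maximum degree two. -/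

section Trees

variable {V : Type u}

theorem SimpleGraph.IsAcyclic.eq_of_common_neighbor {G : SimpleGraph V} (hG : G.IsAcyclic)
    {a a' b b' : V} (ha : a ≠ a') (h1 : G.Adj a b) (h2 : G.Adj b a') (h3 : G.Adj a b')
    (h4 : G.Adj b' a') : b = b' := by
  have p1 : (SimpleGraph.Walk.cons h1 (SimpleGraph.Walk.cons h2 .nil)).IsPath := by
    simp [ha, h1.ne, h2.ne]
  have p2 : (SimpleGraph.Walk.cons h3 (SimpleGraph.Walk.cons h4 .nil)).IsPath := by
    simp [ha, h3.ne, h4.ne]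
  have := congrArg (fun p => p.1.getVert 1) ((hG.subsingleton_path _ _).elim ⟨_, p1⟩ ⟨_, p2⟩)
  simpa using this

theorem SimpleGraph.IsAcyclic.not_adj_of_adj_of_adj {G : SimpleGraph V} (hG : G.IsAcyclic)
    {a b c : V} (h1 : G.Adj a b) (h2 : G.Adj b c) : ¬ G.Adj a c := by
  intro h3
  have p1 : (SimpleGraph.Walk.cons h1 (SimpleGraph.Walk.cons h2 .nil)).IsPath := by
    simp [h1.ne, h2.ne, h3.ne]
  have p2 : (SimpleGraph.Walk.cons h3 .nil).IsPath := by simp [h3.ne]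
  have := congrArg (fun p => p.1.length) ((hG.subsingleton_path _ _).elim ⟨_, p1⟩ ⟨_, p2⟩)
  simp at this

/-- The set `S` of `k` vertices induces a subgraph of `G` that contains a spanning star. -/
def IsSpannedByStar (G : SimpleGraph V) (k : ℕ) (S : Finset V) : Prop :=
  S.card = k ∧ ∃ c ∈ S, ∀ w ∈ S, w ≠ c → G.Adj c w

/-- A star centre is isolated in the complement. Conversely, if the complement is disconnected on
`S`, `T` joins every vertex of one component to every vertex outside it; without a star both sides
have two vertices, giving a 4-cycle in `T`. -/
theorem connected_induce_compl_iff {T : SimpleGraph V} (hT : T.IsAcyclic) {k : ℕ} (hk : 2 ≤ k)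
    {S : Finset V} (hS : S.card = k) :
    (Tᶜ.induce (S : Set V)).Connected ↔ ¬ IsSpannedByStar T k S := by
  classical
  constructor
  · rintro hc ⟨-, c, hcS, hstar⟩
    obtain ⟨w, hw, hwc⟩ := Finset.exists_mem_ne (by omega : 1 < S.card) c
    obtain ⟨p⟩ := hc.preconnected ⟨c, hcS⟩ ⟨w, hw⟩
    cases p with
    | nil => exact hwc rfl
    | @cons _ x _ h _ =>
      rw [SimpleGraph.comap_adj, SimpleGraph.compl_adj] at h
      exact h.2 (hstar x x.2 h.1.symm)
  · intro hstar
    have hne : Nonempty (S : Set V) := by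
      obtain ⟨x, hx⟩ := Finset.card_pos.1 (by omega : 0 < S.card)
      exact ⟨⟨x, hx⟩⟩
    refine ⟨fun x y => ?_⟩
    by_contra hxy
    set H := Tᶜ.induce (S : Set V)
    have hadj : ∀ z w : (S : Set V), H.Reachable x z → ¬ H.Reachable x w → T.Adj z w := by
      intro z w hz hw
      by_contra h
      refine hw (hz.trans (SimpleGraph.Adj.reachable ?_))
      rw [SimpleGraph.comap_adj, SimpleGraph.compl_adj]
      refine ⟨fun he => hw ?_, h⟩
      have : z = w := Subtype.ext he
      rwa [← this]
    have hex : ∀ v : (S : Set V), ∃ w : (S : Set V), w ≠ v ∧ ¬ T.Adj v w := by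
      intro v
      by_contra hcon
      push Not at hcon
      exact hstar ⟨hS, v, v.2, fun w hw hwv => hcon ⟨w, hw⟩ fun h => hwv (congrArg Subtype.val h)⟩
    obtain ⟨x', hx', hxx'⟩ := hex x
    obtain ⟨y', hy', hyy'⟩ := hex y
    have rx' : H.Reachable x x' := by
      by_contra h
      exact hxx' (hadj x x' (SimpleGraph.Reachable.refl x) h)
    have ry' : ¬ H.Reachable x y' := fun h => hyy' (hadj y' y h hxy).symm
    refine hy' (Subtype.ext (hT.eq_of_common_neighbor (a := x) (a' := x')
      (fun h => hx' (Subtype.ext h.symm)) ?_ ?_ ?_ ?_))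
    · exact hadj _ _ (.refl x) ry'
    · exact (hadj _ _ rx' ry').symm
    · exact hadj _ _ (.refl x) hxy
    · exact (hadj _ _ rx' hxy).symm

/-- Both sets are closed neighbourhoods of distinct centres. Adjacent centres share only themselves,
there being no triangle; non-adjacent ones share at most one common neighbour. -/
theorem IsSpannedByStar.card_inter_le_two [Fintype V] [DecidableEq V] {T : SimpleGraph V}
    [DecidableRel T.Adj] (hT : T.IsAcyclic) {r : ℕ} (hdeg : T.maxDegree ≤ r) {H H' : Finset V}
    (h : IsSpannedByStar T (r + 1) H) (h' : IsSpannedByStar T (r + 1) H') (hne : H ≠ H') :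
    (H ∩ H').card ≤ 2 := by
  have key : ∀ (c : V) (S : Finset V), S.card = r + 1 → (∀ w ∈ S, w ≠ c → T.Adj c w) →
      S = insert c (T.neighborFinset c) := by
    intro c S hS hc
    refine Finset.eq_of_subset_of_card_le (fun w hw => ?_) ?_
    · rw [Finset.mem_insert, SimpleGraph.mem_neighborFinset]
      exact or_iff_not_imp_left.2 (hc w hw)
    · refine (Finset.card_insert_le _ _).trans ?_
      rw [SimpleGraph.card_neighborFinset_eq_degree, hS]
      exact Nat.succ_le_succ ((T.degree_le_maxDegree c).trans hdeg)
  obtain ⟨hH, c, hc, hcH⟩ := h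
  obtain ⟨hH', c', hc', hcH'⟩ := h'
  have hcc : c ≠ c' := by
    rintro rfl
    exact hne ((key c H hH hcH).trans (key c H' hH' hcH').symm)
  by_cases hadj : T.Adj c c'
  · refine (Finset.card_le_card (t := {c, c'}) fun w hw => ?_).trans Finset.card_le_two
    obtain ⟨h1, h2⟩ := Finset.mem_inter.1 hw
    rw [Finset.mem_insert, Finset.mem_singleton]
    by_contra hcon
    push Not at hcon
    exact hT.not_adj_of_adj_of_adj hadj (hcH' w h2 hcon.2) (hcH w h1 hcon.1)
  · have hmem : ∀ w ∈ H ∩ H', T.Adj c w ∧ T.Adj w c' := by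
      intro w hw
      obtain ⟨h1, h2⟩ := Finset.mem_inter.1 hw
      have n1 : w ≠ c := by
        rintro rfl
        exact hadj (hcH' w h2 hcc).symm
      have n2 : w ≠ c' := by
        rintro rfl
        exact hadj (hcH w h1 hcc.symm)
      exact ⟨hcH w h1 n1, (hcH' w h2 n2).symm⟩
    refine (Finset.card_le_one.2 fun w hw w' hw' => ?_).trans one_le_two
    exact hT.eq_of_common_neighbor hcc (hmem w hw).1 (hmem w hw).2 (hmem w' hw').1 (hmem w' hw').2

/-- A finite tree of maximum degree at most two is a path. -/
theorem SimpleGraph.IsTree.exists_iso_pathGraph [Fintype V] {T : SimpleGraph V}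
    [DecidableRel T.Adj] (hT : T.IsTree) (hdeg : T.maxDegree ≤ 2) :
    ∃ n, Nonempty (T ≃g SimpleGraph.pathGraph n) := by
  classical
  obtain ⟨v₀⟩ := hT.connected.nonempty
  let P : ℕ → Prop := fun n => ∃ (a b : V) (p : T.Walk a b), p.IsPath ∧ p.length = n
  have hP0 : P 0 := ⟨v₀, v₀, .nil, .nil, rfl⟩
  have hPb : ∀ n, P n → n ≤ Fintype.card V := by
    rintro _ ⟨a, b, p, hp, rfl⟩
    exact hp.length_lt.le
  obtain ⟨a, b, p, hp, hlen⟩ := Nat.findGreatest_spec (Nat.zero_le (Fintype.card V)) hP0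
  have hmax : ∀ n, P n → n ≤ p.length := fun n hn => hlen ▸ Nat.le_findGreatest (hPb n hn) hn
  -- A neighbour of an end of a longest path lies on the path, and by acyclicity is the next vertex.
  have hstart : ∀ (a b : V) (p : T.Walk a b), p.IsPath → (∀ n, P n → n ≤ p.length) →
      ∀ y, T.Adj a y → p.toSubgraph.Adj a y := by
    intro a b p hp hmax y hy
    have hys : y ∈ p.support := by
      by_contra hys
      have := hmax (p.length + 1) ⟨y, b, .cons hy.symm p, by simp [hp, hys], by simp⟩
      omega
    have hnil : ¬ p.Nil := by
      intro hnil
      have := SimpleGraph.Walk.nil_iff_support_eq.1 hnil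
      rw [this, List.mem_singleton] at hys
      exact hy.ne hys.symm
    rw [hT.isAcyclic.eq_snd_of_adj_start hp hy hys]
    exact p.toSubgraph_adj_snd hnil
  have hclosed : ∀ x ∈ p.support, ∀ y, T.Adj x y → p.toSubgraph.Adj x y := by
    intro x hx y hy
    obtain ⟨i, rfl, hi⟩ := SimpleGraph.Walk.mem_support_iff_exists_getVert.1 hx
    rcases Nat.eq_zero_or_pos i with rfl | hi0
    · rw [p.getVert_zero] at hy ⊢
      exact hstart a b p hp hmax y hy
    rcases hi.eq_or_lt with rfl | hi
    · rw [p.getVert_length] at hy ⊢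
      rw [← p.toSubgraph_reverse]
      exact hstart b a p.reverse hp.reverse (by simpa using hmax) y hy
    -- An inner vertex already has two neighbours on the path, so the degree bound leaves no other.
    have h2 := hp.ncard_neighborSet_toSubgraph_internal_eq_two hi0.ne' hi
    have h3 : (T.neighborSet (p.getVert i)).ncard ≤ 2 := by
      rw [← SimpleGraph.coe_neighborFinset, Set.ncard_coe_finset,
        SimpleGraph.card_neighborFinset_eq_degree]
      exact (T.degree_le_maxDegree _).trans hdeg
    have h4 := Set.eq_of_subset_of_ncard_le (p.toSubgraph.neighborSet_subset (p.getVert i))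
      (h3.trans h2.ge) (Set.toFinite _)
    exact (h4 ▸ hy : y ∈ p.toSubgraph.neighborSet (p.getVert i))
  have hall : ∀ x, x ∈ p.support := by
    intro x
    obtain ⟨w⟩ := hT.connected.preconnected a x
    have : ∀ (c d : V) (w : T.Walk c d), c ∈ p.support → d ∈ p.support := by
      intro c d w
      induction w with
      | nil => exact id
      | cons h _ ih =>
        intro hc
        exact ih (p.mem_verts_toSubgraph.1 (p.toSubgraph.edge_vert (hclosed _ hc _ h).symm))
    exact this a x w p.start_mem_support
  have htop : p.toSubgraph = ⊤ := by
    refine top_le_iff.1 ⟨fun x _ => p.mem_verts_toSubgraph.2 (hall x), fun x y h => ?_⟩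
    exact hclosed x (hall x) y h
  refine ⟨p.length + 1, ⟨?_⟩⟩
  have e1 := hp.pathGraphIsoToSubgraph
  rw [htop] at e1
  exact (e1.trans SimpleGraph.Subgraph.topIso).symm

end Trees

/-! ### Swaps and tight constraints: small intersections and consecutive triples. -/

section Exchange

variable {V : Type u} [DecidableEq V] {Bad : Finset V → Prop} {k : ℕ}

theorem eq_of_subset_inter_of_card_inter_le_two
    (hsp : ∀ H H', Bad H → Bad H' → H ≠ H' → (H ∩ H').card ≤ 2) {X Y Z : Finset V} (hX : Bad X)
    (hY : Bad Y) (hZX : Z ⊆ X) (hZY : Z ⊆ Y) (hZ : 3 ≤ Z.card) : X = Y := by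
  by_contra h
  have := hsp X Y hX hY h
  have := Finset.card_le_card (Finset.subset_inter hZX hZY)
  omega

/-- Among two replacements for an element of a set, at least one is not bad. -/
theorem exists_not_insert_of_card_inter_le_two
    (hsp : ∀ H H', Bad H → Bad H' → H ≠ H' → (H ∩ H').card ≤ 2) {A Z : Finset V} (hZ : 3 ≤ Z.card)
    (hA : 2 ≤ A.card) (hAZ : Disjoint A Z) : ∃ a ∈ A, ¬ Bad (insert a Z) := by
  obtain ⟨a, ha, a', ha', hne⟩ := Finset.one_lt_card.1 (by omega : 1 < A.card)
  by_contra! h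
  have := eq_of_subset_inter_of_card_inter_le_two hsp (h a ha) (h a' ha')
    (Finset.subset_insert _ _) (Finset.subset_insert _ _) hZ
  have h1 : a ∈ insert a' Z := this ▸ Finset.mem_insert_self a Z
  rcases Finset.mem_insert.1 h1 with h2 | h2
  · exact hne h2
  · exact Finset.disjoint_left.1 hAZ ha h2

/-- As `k ≥ 4`, deleting an element leaves at least three, and these lie in at most one bad set. So
one of two candidates `a ∈ H \ S` suits `S`, while `H` minus `a` completes only to `H`. -/
theorem exists_swap_of_card_inter_le_two (hk : 4 ≤ k) (hcard : ∀ H, Bad H → H.card = k)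
    (hsp : ∀ H H', Bad H → Bad H' → H ≠ H' → (H ∩ H').card ≤ 2)
    (H S : Finset V) (hH : Bad H) (hS : S.card = k) (hSH : (S ∩ H).card + 2 ≤ k) :
    ∃ a ∈ H, a ∉ S ∧ ∃ b ∈ S, b ∉ H ∧ ¬ Bad (insert b (H.erase a)) ∧
      ¬ Bad (insert a (S.erase b)) := by
  have h1 := Finset.card_sdiff_add_card_inter S H
  have h2 := Finset.card_sdiff_add_card_inter H S
  rw [Finset.inter_comm H S, hcard H hH] at h2
  obtain ⟨b, hb⟩ := Finset.card_pos.1 (by omega : 0 < (S \ H).card)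
  rw [Finset.mem_sdiff] at hb
  obtain ⟨a, ha, hbad⟩ := exists_not_insert_of_card_inter_le_two hsp (A := H \ S)
    (Z := S.erase b) (by rw [Finset.card_erase_of_mem hb.1]; omega) (by omega)
    (Finset.disjoint_of_subset_right (Finset.erase_subset _ _) Finset.sdiff_disjoint)
  rw [Finset.mem_sdiff] at ha
  refine ⟨a, ha.1, ha.2, b, hb.1, hb.2, fun h => hb.2 ?_, hbad⟩
  have := eq_of_subset_inter_of_card_inter_le_two hsp h hH (Finset.subset_insert _ _)
    (Finset.erase_subset _ _) (by rw [Finset.card_erase_of_mem ha.1, hcard H hH]; omega)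
  rw [← this]
  exact Finset.mem_insert_self _ _

/-- Two distinct tight sets through `t` would give `2 q (k - 1) < q k + 2 q`, because they share at
most two vertices and `g t < q`. This is impossible for `k ≥ 4`. -/
theorem exists_best_tight_of_card_inter_le_two [Finite V] [LinearOrder V] (hk : 4 ≤ k)
    (hsp : ∀ H H', Bad H → Bad H' → H ≠ H' → (H ∩ H').card ≤ 2) {q : ℕ} {g : V →₀ ℕ}
    (hg : g ∈ boundedExponents Bad k q) {t : V} (ht : g t < q) :
    (∀ H, Bad H → t ∈ H → ∑ x ∈ H, g x ≠ q * (k - 1)) ∨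
      ∃ H₀, Bad H₀ ∧ t ∈ H₀ ∧ ∑ x ∈ H₀, g x = q * (k - 1) ∧
        ∀ H, Bad H → t ∈ H → ∑ x ∈ H, g x = q * (k - 1) → ∀ l ∈ H₀, t < l → l ∈ H := by
  have := Fintype.ofFinite V
  by_cases hex : ∀ H, Bad H → t ∈ H → ∑ x ∈ H, g x ≠ q * (k - 1)
  · exact Or.inl hex
  push Not at hex
  obtain ⟨H₀, h1, h2, h3⟩ := hex
  refine Or.inr ⟨H₀, h1, h2, h3, fun H h4 h5 h6 l hl _ => ?_⟩
  by_cases hne : H = H₀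
  · rwa [hne]
  exfalso
  have e1 := Finset.sum_union_inter (s₁ := H) (s₂ := H₀) (f := g)
  have e2 : ∑ x ∈ H ∪ H₀, g x ≤ q * k := by
    rw [← hg.2.1, Finsupp.degree_eq_sum]
    exact Finset.sum_le_sum_of_subset (Finset.subset_univ _)
  have e3 : ∑ x ∈ H ∩ H₀, g x < 2 * q := by
    calc ∑ x ∈ H ∩ H₀, g x < ∑ _x ∈ H ∩ H₀, q :=
          Finset.sum_lt_sum (fun i _ => hg.1 i) ⟨t, Finset.mem_inter.2 ⟨h5, h2⟩, ht⟩
      _ = (H ∩ H₀).card * q := by rw [Finset.sum_const, smul_eq_mul]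
      _ ≤ 2 * q := Nat.mul_le_mul_right _ (hsp H H₀ h4 h1 hne)
  obtain ⟨j, rfl⟩ := Nat.exists_eq_add_of_le hk
  have e4 : q * (4 + j) = 4 * q + q * j := by ring
  have e5 : q * (4 + j - 1) = 3 * q + q * j := by
    rw [show 4 + j - 1 = 3 + j by omega]; ring
  rw [e4] at e2
  rw [h6, h3, e5] at e1
  have := Nat.zero_le (q * j)
  omega

/-- With two candidates in `S' \ S` at most one is bad; with a single candidate the exchange yields
`S'` itself. -/
theorem exists_exchange_of_card_inter_le_two (hk : 4 ≤ k)
    (hsp : ∀ H H', Bad H → Bad H' → H ≠ H' → (H ∩ H').card ≤ 2) {S S' : Finset V}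
    (hS : S.card = k) (hS' : S'.card = k) (hgood : ¬ Bad S') {i : V} (hi : i ∈ S) (hi' : i ∉ S') :
    ∃ j ∈ S', j ∉ S ∧ ¬ Bad (insert j (S.erase i)) := by
  have h1 := Finset.card_sdiff_add_card_inter S S'
  have h2 := Finset.card_sdiff_add_card_inter S' S
  rw [Finset.inter_comm S' S] at h2
  have h3 : 0 < (S \ S').card := Finset.card_pos.2 ⟨i, Finset.mem_sdiff.2 ⟨hi, hi'⟩⟩
  by_cases hc : 2 ≤ (S' \ S).card
  · obtain ⟨j, hj, hbad⟩ := exists_not_insert_of_card_inter_le_two hsp (A := S' \ S)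
      (Z := S.erase i) (by rw [Finset.card_erase_of_mem hi]; omega) hc
      (Finset.disjoint_of_subset_right (Finset.erase_subset _ _) Finset.sdiff_disjoint)
    rw [Finset.mem_sdiff] at hj
    exact ⟨j, hj.1, hj.2, hbad⟩
  · obtain ⟨j, hj⟩ := Finset.card_eq_one.1 (by omega : (S' \ S).card = 1)
    obtain ⟨i', hii⟩ := Finset.card_eq_one.1 (by omega : (S \ S').card = 1)
    have hjm : j ∈ S' ∧ j ∉ S := by
      rw [← Finset.mem_sdiff, hj]; exact Finset.mem_singleton_self j
    refine ⟨j, hjm.1, hjm.2, ?_⟩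
    have : insert j (S.erase i) = S' := by
      have hi2 : i = i' := by
        rw [← Finset.mem_singleton, ← hii, Finset.mem_sdiff]; exact ⟨hi, hi'⟩
      ext x
      have a1 : x ∈ S' \ S ↔ x = j := by rw [hj, Finset.mem_singleton]
      have a2 : x ∈ S \ S' ↔ x = i := by rw [hii, Finset.mem_singleton, hi2]
      rw [Finset.mem_sdiff] at a1 a2
      rw [Finset.mem_insert, Finset.mem_erase]
      grind
    rwa [this]

/-- Every member of the family `Bad` consists of three consecutive vertices. -/
def IsConsecutive (pos : V → ℕ) (Bad : Finset V → Prop) : Prop :=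
  ∀ H, Bad H → ∃ x y z, H = {x, y, z} ∧ pos y = pos x + 1 ∧ pos z = pos x + 2

/-- Let `H = {x, y, z}`. If `y ∉ S`, give away the middle `y`: `x` and `z` without `y` never lie in
a bad triple. If `y ∈ S`, give away `x`; the two other elements of `S` cannot both fail as partners.
-/
theorem exists_swap_of_isConsecutive {pos : V → ℕ} (hpos : Function.Injective pos)
    (hc : IsConsecutive pos Bad) (H S : Finset V) (hH : Bad H) (hS : S.card = 3)
    (hSH : (S ∩ H).card + 2 ≤ 3) :
    ∃ a ∈ H, a ∉ S ∧ ∃ b ∈ S, b ∉ H ∧ ¬ Bad (insert b (H.erase a)) ∧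
      ¬ Bad (insert a (S.erase b)) := by
  have hdiam : ∀ X, Bad X → ∀ u ∈ X, ∀ w ∈ X, pos w ≤ pos u + 2 := by
    intro X hX u hu w hw
    obtain ⟨x, y, z, rfl, h1, h2⟩ := hc X hX
    simp only [Finset.mem_insert, Finset.mem_singleton] at hu hw
    rcases hu with rfl | rfl | rfl <;> rcases hw with rfl | rfl | rfl <;> omega
  have hmid : ∀ X, Bad X → ∀ u ∈ X, ∀ w ∈ X, pos w = pos u + 2 → ∃ v ∈ X, pos v = pos u + 1 := by
    intro X hX u hu w hw huw
    obtain ⟨x, y, z, rfl, h1, h2⟩ := hc X hX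
    refine ⟨y, by simp, ?_⟩
    simp only [Finset.mem_insert, Finset.mem_singleton] at hu hw
    rcases hu with rfl | rfl | rfl <;> rcases hw with rfl | rfl | rfl <;> omega
  have hnbr : ∀ X, Bad X → ∀ u ∈ X, ∃ v ∈ X, pos v = pos u + 1 ∨ pos u = pos v + 1 := by
    intro X hX u hu
    obtain ⟨x, y, z, rfl, h1, h2⟩ := hc X hX
    simp only [Finset.mem_insert, Finset.mem_singleton] at hu
    rcases hu with rfl | rfl | rfl
    · exact ⟨y, by simp, by omega⟩
    · exact ⟨z, by simp, by omega⟩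
    · exact ⟨y, by simp, by omega⟩
  obtain ⟨x, y, z, rfl, hy, hz⟩ := hc H hH
  have hinj : ∀ {u v : V}, pos u = pos v → u = v := fun h => hpos h
  have hxy : x ≠ y := fun h => by rw [h] at hy; omega
  have hyz : y ≠ z := fun h => by rw [h] at hy; omega
  have hxz : x ≠ z := fun h => by rw [h] at hz; omega
  have hout : ∀ b, b ≠ y → ¬ Bad (insert b (({x, y, z} : Finset V).erase y)) := by
    intro b hb hbad
    obtain ⟨v, hv, hvp⟩ := hmid _ hbad x (by simp [hxy]) z (by simp [hyz.symm]) hz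
    have : v = y := hinj (by omega)
    subst this
    simp [hb.symm] at hv
  have hsplit : ∀ u ∈ S, u ∈ ({x, y, z} : Finset V) → (∀ w ∈ S, w ∈ ({x, y, z} : Finset V) → w = u) ∧
      ∃ b ∈ S, ∃ b' ∈ S, b ≠ b' ∧ b ≠ u ∧ b' ≠ u := by
    intro u hu huH
    refine ⟨fun w hw hwH => Finset.card_le_one.1 (by omega : (S ∩ {x, y, z}).card ≤ 1) w
      (Finset.mem_inter.2 ⟨hw, hwH⟩) u (Finset.mem_inter.2 ⟨hu, huH⟩), ?_⟩
    obtain ⟨b, b', hbb, he⟩ := Finset.card_eq_two.1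
      (by rw [Finset.card_erase_of_mem hu, hS] : (S.erase u).card = 2)
    have h1 : b ∈ S.erase u := by rw [he]; simp
    have h2 : b' ∈ S.erase u := by rw [he]; simp
    rw [Finset.mem_erase] at h1 h2
    exact ⟨b, h1.2, b', h2.2, hbb, h1.1, h2.1⟩
  simp only [Finset.mem_insert, Finset.mem_singleton] at hsplit ⊢
  -- a vertex of `S` outside of `{x, y, z}` whose position is not `p` can be kept
  have hkeep : ∀ u ∈ S, (u = x ∨ u = y ∨ u = z) → ∀ p : ℕ, ∃ b ∈ S, ∃ b' ∈ S,
      b ≠ b' ∧ b ≠ u ∧ b' ≠ u ∧ pos b' ≠ p := by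
    intro u hu huH p
    obtain ⟨-, b, hb, b', hb', hbb, hbu, hbu'⟩ := hsplit u hu huH
    by_cases h : pos b' = p
    · exact ⟨b', hb', b, hb, hbb.symm, hbu', hbu, fun h' => hbb (hinj (h'.trans h.symm))⟩
    · exact ⟨b, hb, b', hb', hbb, hbu, hbu', h⟩
  by_cases hyS : y ∈ S
  · obtain ⟨huniq, b₁, hb₁, b₂, hb₂, hbb, hb₁y, hb₂y⟩ := hsplit y hyS (by simp)
    have hxS : x ∉ S := fun h => hxy (huniq x h (by simp))
    have hzS : z ∉ S := fun h => hyz (huniq z h (by simp)).symm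
    -- exchanging `x` and `b` works unless `b` follows `z` or `b'` precedes `x`
    have hx : ∀ b ∈ S, ∀ b' ∈ S, b ≠ b' → b ≠ y → b' ≠ y → pos b ≠ pos z + 1 →
        pos b' + 1 ≠ pos x → ¬ Bad (insert b (({x, y, z} : Finset V).erase x)) ∧
          ¬ Bad (insert x (S.erase b)) := by
      intro b hb b' hb' hne hby hby' h1 h2
      have nb : pos b ≠ pos x := fun h => hxS (hinj h ▸ hb)
      have nb2 : pos b ≠ pos z := fun h => hzS (hinj h ▸ hb)
      have nb3 : pos b ≠ pos y := fun h => hby (hinj h)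
      have nb' : pos b' ≠ pos x := fun h => hxS (hinj h ▸ hb')
      have nb2' : pos b' ≠ pos z := fun h => hzS (hinj h ▸ hb')
      have nb3' : pos b' ≠ pos y := fun h => hby' (hinj h)
      constructor
      · intro hbad
        have d1 := hdiam _ hbad b (by simp) z (by simp [hxz.symm])
        have d2 := hdiam _ hbad y (by simp [hxy.symm]) b (by simp)
        omega
      · intro hbad
        have d1 := hdiam _ hbad b' (by simp [hb', hne.symm]) y (by simp [hyS, hby.symm])
        have d2 := hdiam _ hbad x (by simp) b' (by simp [hb', hne.symm])
        omega
    have hmem : ∀ b ∈ S, b ≠ y → ¬ (b = x ∨ b = y ∨ b = z) := by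
      rintro b hb hby (rfl | rfl | rfl)
      exacts [hxS hb, hby rfl, hzS hb]
    refine ⟨x, by simp, hxS, ?_⟩
    by_cases h : pos b₁ ≠ pos z + 1 ∧ pos b₂ + 1 ≠ pos x
    · exact ⟨b₁, hb₁, hmem b₁ hb₁ hb₁y, hx b₁ hb₁ b₂ hb₂ hbb hb₁y hb₂y h.1 h.2⟩
    · refine ⟨b₂, hb₂, hmem b₂ hb₂ hb₂y, hx b₂ hb₂ b₁ hb₁ hbb.symm hb₂y hb₁y ?_ ?_⟩
      · intro h'
        have : pos b₁ ≠ pos b₂ := fun e => hbb (hinj e)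
        omega
      · intro h'
        have : pos b₁ ≠ pos b₂ := fun e => hbb (hinj e)
        omega
  · refine ⟨y, by simp, hyS, ?_⟩
    by_cases hxS : x ∈ S
    -- With `z ∉ S`, only a kept `b'` just before `x` could complete `x, y` to a bad triple. If `pos
    -- x = 0`, the truncated value is the position of `x`, already excluded.
    · obtain ⟨b, hb, b', hb', hbb, hbx, hbx', hp⟩ := hkeep x hxS (by simp) (pos x - 1)
      have huniq := (hsplit x hxS (by simp)).1
      have hzS : z ∉ S := fun h => hxz (huniq z h (by simp)).symm
      have hby : b ≠ y := fun h => hyS (h ▸ hb)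
      refine ⟨b, hb, fun h => hbx (huniq b hb h), hout b hby, fun hbad => ?_⟩
      have d1 := hdiam _ hbad b' (by simp [hb', hbb.symm]) y (by simp)
      have d2 := hdiam _ hbad x (by simp [hxS, hbx.symm]) b' (by simp [hb', hbb.symm])
      have nb' : pos b' ≠ pos x := fun h => hbx' (hinj h)
      have nb2' : pos b' ≠ pos z := fun h => hzS (hinj h ▸ hb')
      have nb3' : pos b' ≠ pos y := fun h => hyS (hinj h ▸ hb')
      omega
    · by_cases hzS : z ∈ S
      · obtain ⟨b, hb, b', hb', hbb, hbz, hbz', hp⟩ := hkeep z hzS (by simp) (pos z + 1)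
        have huniq := (hsplit z hzS (by simp)).1
        have hby : b ≠ y := fun h => hyS (h ▸ hb)
        refine ⟨b, hb, fun h => hbz (huniq b hb h), hout b hby, fun hbad => ?_⟩
        have d1 := hdiam _ hbad b' (by simp [hb', hbb.symm]) z (by simp [hzS, hbz.symm])
        have d2 := hdiam _ hbad y (by simp) b' (by simp [hb', hbb.symm])
        have nb' : pos b' ≠ pos z := fun h => hbz' (hinj h)
        have nb2' : pos b' ≠ pos x := fun h => hxS (hinj h ▸ hb')
        have nb3' : pos b' ≠ pos y := fun h => hyS (hinj h ▸ hb')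
        omega
      · obtain ⟨b, hb⟩ := Finset.card_pos.1 (by omega : 0 < S.card)
        have hby : b ≠ y := fun h => hyS (h ▸ hb)
        refine ⟨b, hb, ?_, hout b hby, fun hbad => ?_⟩
        · rintro (rfl | rfl | rfl)
          exacts [hxS hb, hyS hb, hzS hb]
        -- Here `S` misses `H`, so `y` would have no neighbour in the new set.
        · obtain ⟨v, hv, hvp⟩ := hnbr _ hbad y (by simp)
          rw [Finset.mem_insert, Finset.mem_erase] at hv
          rcases hv with rfl | ⟨-, hv⟩
          · omega
          · rcases hvp with h | h
            · exact hzS (hinj (by omega : pos v = pos z) ▸ hv)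
            · exact hxS (hinj (by omega : pos v = pos x) ▸ hv)

/-- If `t` were last in a tight set, `f` would violate that constraint. So tight sets through `t`
have `t` in the middle or first, with later parts `{t + 1}` and `{t + 1, t + 2}`; a set of the
former kind is preferred. -/
theorem exists_best_tight_of_isConsecutive [Finite V] [LinearOrder V] {pos : V → ℕ}
    (hpos : Function.Injective pos) (hlt : ∀ a b, a < b ↔ pos a < pos b)
    (hc : IsConsecutive pos Bad) {q : ℕ} {f g : V →₀ ℕ} (hf : f ∈ boundedExponents Bad 3 q)
    {t : V} (hfg : ∀ i < t, f i = g i) (ht : g t < f t) :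
    (∀ H, Bad H → t ∈ H → ∑ x ∈ H, g x ≠ q * (3 - 1)) ∨
      ∃ H₀, Bad H₀ ∧ t ∈ H₀ ∧ ∑ x ∈ H₀, g x = q * (3 - 1) ∧
        ∀ H, Bad H → t ∈ H → ∑ x ∈ H, g x = q * (3 - 1) → ∀ l ∈ H₀, t < l → l ∈ H := by
  have hinj : ∀ {u v : V}, pos u = pos v → u = v := fun h => hpos h
  have hlast : ∀ H, Bad H → t ∈ H → ∑ x ∈ H, g x = q * (3 - 1) → ∃ l ∈ H, pos t < pos l := by
    intro H hH htH he
    by_contra! hcon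
    refine absurd ((hf.2.2 H hH).trans he.ge) (not_le.2 (Finset.sum_lt_sum (fun i hi => ?_)
      ⟨t, htH, ht⟩))
    rcases (hcon i hi).eq_or_lt with h | h
    · rw [hinj h]; exact ht.le
    · exact (hfg i ((hlt i t).2 h)).ge
  have hpt : ∀ H, Bad H → t ∈ H → ∑ x ∈ H, g x = q * (3 - 1) →
      (∃ v, pos v = pos t + 1 ∧ v ∈ H ∧ ∀ l ∈ H, t < l → l = v) ∨
      (∃ v w, pos v = pos t + 1 ∧ pos w = pos t + 2 ∧ H = {t, v, w}) := by
    intro H hH htH he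
    obtain ⟨l, hl, hlp⟩ := hlast H hH htH he
    obtain ⟨x, y, z, rfl, h1, h2⟩ := hc H hH
    simp only [Finset.mem_insert, Finset.mem_singleton] at htH hl
    rcases htH with rfl | rfl | rfl
    · exact Or.inr ⟨y, z, h1, h2, rfl⟩
    · refine Or.inl ⟨z, by omega, by simp, fun l' hl' htl' => ?_⟩
      rw [hlt] at htl'
      simp only [Finset.mem_insert, Finset.mem_singleton] at hl'
      rcases hl' with rfl | rfl | rfl
      · omega
      · omega
      · rfl
    · rcases hl with rfl | rfl | rfl <;> omega
  by_cases h1 : ∃ H, Bad H ∧ t ∈ H ∧ ∑ x ∈ H, g x = q * (3 - 1) ∧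
      ∃ v, pos v = pos t + 1 ∧ v ∈ H ∧ ∀ l ∈ H, t < l → l = v
  · obtain ⟨H₀, hH₀, htH₀, he₀, v, hv, -, hl⟩ := h1
    refine Or.inr ⟨H₀, hH₀, htH₀, he₀, fun H hH htH he l hlH htl => ?_⟩
    rw [hl l hlH htl]
    rcases hpt H hH htH he with ⟨v', hv', hvH, -⟩ | ⟨v', w', hv', -, rfl⟩
    · rwa [hinj (hv.trans hv'.symm)]
    · rw [hinj (hv.trans hv'.symm)]; simp
  · by_cases h2 : ∀ H, Bad H → t ∈ H → ∑ x ∈ H, g x ≠ q * (3 - 1)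
    · exact Or.inl h2
    push Not at h2
    obtain ⟨H₀, hH₀, htH₀, he₀⟩ := h2
    refine Or.inr ⟨H₀, hH₀, htH₀, he₀, fun H hH htH he l hlH _ => ?_⟩
    rcases hpt H hH htH he with h | ⟨v, w, hv, hw, rfl⟩
    · exact absurd ⟨H, hH, htH, he, h⟩ h1
    rcases hpt H₀ hH₀ htH₀ he₀ with h | ⟨v', w', hv', hw', rfl⟩
    · exact absurd ⟨H₀, hH₀, htH₀, he₀, h⟩ h1
    rwa [hinj (hv.trans hv'.symm), hinj (hw.trans hw'.symm)]

end Exchange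

/-! ### Application to the connected ideals of tree complements. -/

section ConnectedIdeals

variable {V : Type u} {K : Type v} [Field K]

theorem finite_boundedExponents [Finite V] (Bad : Finset V → Prop) (k q : ℕ) :
    (boundedExponents Bad k q).Finite := by
  classical
  refine (Set.finite_Icc 0 (Finsupp.equivFunOnFinite.symm fun _ : V => q)).subset ?_
  exact fun m hm => ⟨fun i => Nat.zero_le _, fun i => hm.1 i⟩

theorem degree_of_mem_boundedExponents {Bad : Finset V → Prop} {k q : ℕ} :
    ∀ m ∈ boundedExponents Bad k q, m.degree = q * k := fun _ hm => hm.2.1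

theorem connectedIdeal_compl_pow {T : SimpleGraph V} (hT : T.IsAcyclic) {r : ℕ} (hr : 1 ≤ r)
    (q : ℕ) : connectedIdeal K Tᶜ r ^ q = Ideal.span ((fun m => monomial m (1 : K)) ''
      goodSums (IsSpannedByStar T (r + 1)) (r + 1) q) := by
  rw [← span_goodSums_pow, goodSums_one, connectedIdeal]
  congr 2
  ext f
  simp only [Set.mem_image, exists_exists_and_eq_and]
  refine exists_congr fun S => ?_
  rw [prod_X_eq_monomial_indicatorExponent, ← and_assoc]
  refine and_congr (and_congr_right fun hS => ?_) eq_comm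
  exact connected_induce_compl_iff hT (by omega) hS

theorem hasLinearResolution_span_boundedExponents [Finite V] [LinearOrder V]
    {Bad : Finset V → Prop} {k q : ℕ}
    (htight : ∀ f ∈ boundedExponents Bad k q, ∀ g ∈ boundedExponents Bad k q, ∀ t,
      (∀ i < t, f i = g i) → g t < f t →
      (∀ H, Bad H → t ∈ H → ∑ x ∈ H, g x ≠ q * (k - 1)) ∨
      ∃ H₀, Bad H₀ ∧ t ∈ H₀ ∧ ∑ x ∈ H₀, g x = q * (k - 1) ∧
        ∀ H, Bad H → t ∈ H → ∑ x ∈ H, g x = q * (k - 1) → ∀ l ∈ H₀, t < l → l ∈ H) :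
    HasLinearResolution
      (Ideal.span ((fun m => monomial m (1 : K)) '' boundedExponents Bad k q)) := by
  have hmem : ∀ m : Lex (V →₀ ℕ),
      m ∈ (finite_boundedExponents Bad k q).toFinset.map toLex.toEmbedding ↔
        ofLex m ∈ boundedExponents Bad k q := by
    intro m
    rw [Finset.mem_map_equiv, Set.Finite.mem_toFinset]
    exact Iff.rfl
  obtain ⟨p, hp⟩ := exists_hasLinearSyzygies_of_weak_exchange (K := K)
    ((finite_boundedExponents Bad k q).toFinset.map toLex.toEmbedding) (q * k)
    (fun m hm => ((hmem m).1 hm).2.1) (fun f hf g hg t h1 h2 => by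
      simp only [hmem] at hf hg ⊢
      exact boundedExponents_weak_exchange hf hg h1 h2 (htight _ hf _ hg t h1 h2))
  have hset : {m : V →₀ ℕ | toLex m ∈
      (finite_boundedExponents Bad k q).toFinset.map toLex.toEmbedding} =
        boundedExponents Bad k q := by
    ext m
    exact hmem (toLex m)
  rw [hset] at hp
  exact hp.hasLinearResolution

/-- The star's centre is the middle vertex: its two leaves occupy the two positions next to it. -/
theorem isConsecutive_isSpannedByStar [DecidableEq V] {T : SimpleGraph V} {n : ℕ}
    (e : T ≃g SimpleGraph.pathGraph n) :
    IsConsecutive (fun v => (e v : ℕ)) (IsSpannedByStar T 3) := by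
  rintro H ⟨hH, c, hc, hstar⟩
  obtain ⟨a, b, hab, he⟩ := Finset.card_eq_two.1
    (by rw [Finset.card_erase_of_mem hc, hH] : (H.erase c).card = 2)
  have ha : a ∈ H.erase c := by rw [he]; simp
  have hb : b ∈ H.erase c := by rw [he]; simp
  rw [Finset.mem_erase] at ha hb
  have h1 := e.map_adj_iff.2 (hstar a ha.2 ha.1)
  have h2 := e.map_adj_iff.2 (hstar b hb.2 hb.1)
  rw [SimpleGraph.pathGraph_adj] at h1 h2
  have hne : (e a : ℕ) ≠ e b := fun h => hab (e.injective (Fin.ext h))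
  have hHe : H = {c, a, b} := by rw [← he, Finset.insert_erase hc]
  by_cases hlt : (e a : ℕ) < e b
  · exact ⟨a, c, b, by rw [hHe, Finset.insert_comm], by dsimp only; omega, by dsimp only; omega⟩
  · refine ⟨b, c, a, ?_, by dsimp only; omega, by dsimp only; omega⟩
    rw [hHe, Finset.pair_comm, Finset.insert_comm]

end ConnectedIdeals

theorem mainTheorem4 {V : Type*} [Fintype V] (K : Type*) [Field K]
    (T : SimpleGraph V) [DecidableRel T.Adj] (hT : T.IsTree)
    (r : ℕ) (hr : 2 ≤ r) (hdeg : T.maxDegree ≤ r) :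
    (∀ q : ℕ, 1 ≤ q → HasLinearResolution ((connectedIdeal K Tᶜ r) ^ q)) ∧
    (r = 2 → ∃ (n : ℕ) (e : T ≃g SimpleGraph.pathGraph n), ∀ q : ℕ, 1 ≤ q →
      IsWeaklyPolymatroidal e.toEquiv ((connectedIdeal K Tᶜ 2) ^ q)) ∧
    (3 ≤ r → IsPolymatroidal (connectedIdeal K Tᶜ r)) := by
  classical
  have hac := hT.isAcyclic
  have hcard : ∀ H, IsSpannedByStar T (r + 1) H → H.card = r + 1 := fun H hH => hH.1
  have hsp : ∀ H H', IsSpannedByStar T (r + 1) H → IsSpannedByStar T (r + 1) H' → H ≠ H' →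
      (H ∩ H').card ≤ 2 := fun H H' h h' hne => h.card_inter_le_two hac hdeg h' hne
  have hpow : (∀ H S : Finset V, IsSpannedByStar T (r + 1) H → S.card = r + 1 →
      (S ∩ H).card + 2 ≤ r + 1 → ∃ a ∈ H, a ∉ S ∧ ∃ b ∈ S, b ∉ H ∧
        ¬ IsSpannedByStar T (r + 1) (insert b (H.erase a)) ∧
        ¬ IsSpannedByStar T (r + 1) (insert a (S.erase b))) → ∀ q,
      connectedIdeal K Tᶜ r ^ q = Ideal.span ((fun m => monomial m (1 : K)) ''
        boundedExponents (IsSpannedByStar T (r + 1)) (r + 1) q) := fun hswap q => by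
    rw [connectedIdeal_compl_pow hac (by omega), (goodSums_subset_boundedExponents hcard q).antisymm
      (boundedExponents_subset_goodSums (by omega) hcard hswap q)]
  rcases hr.eq_or_lt with rfl | hr
  · obtain ⟨n, ⟨e⟩⟩ := hT.exists_iso_pathGraph hdeg
    have hpos : Function.Injective fun v => (e v : ℕ) :=
      fun a b h => e.injective (Fin.ext h)
    have hcon := isConsecutive_isSpannedByStar e
    have hpow := hpow fun H S hH hS hSH => exists_swap_of_isConsecutive hpos hcon H S hH hS hSH
    let : LinearOrder V := LinearOrder.lift' e e.injective
    have htight := fun q (f : V →₀ ℕ) (hf : f ∈ boundedExponents (IsSpannedByStar T 3) 3 q)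
      (g : V →₀ ℕ) (t : V) => exists_best_tight_of_isConsecutive hpos (fun a b => Iff.rfl)
        (isConsecutive_isSpannedByStar e) hf (g := g) (t := t)
    refine ⟨fun q _ => ?_, fun _ => ⟨n, e, fun q _ => ?_⟩, fun h => absurd h (by omega)⟩
    · rw [hpow]
      exact hasLinearResolution_span_boundedExponents fun f hf g _ t h1 h2 => htight q f hf g t h1 h2
    · rw [hpow]
      refine ⟨isEquigeneratedMonomialIdeal_span_monomial degree_of_mem_boundedExponents, ?_⟩
      rw [minimalMonomials_span_monomial degree_of_mem_boundedExponents]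
      intro f hf g hg t h1 h2
      obtain ⟨l, h3, h4, h5⟩ := boundedExponents_weak_exchange hf hg h1 h2
        (htight q f hf g t h1 h2)
      exact ⟨l, h3, h4, Ideal.subset_span ⟨_, h5, rfl⟩⟩
  · have hpow := hpow fun H S hH hS hSH =>
      exists_swap_of_card_inter_le_two (by omega) hcard hsp H S hH hS hSH
    refine ⟨fun q _ => ?_, fun h => absurd h (by omega), fun _ => ?_⟩
    · rw [hpow]
      -- Any order works here, since at most one tight set contains `t`.
      let : LinearOrder V := LinearOrder.lift' (Fintype.equivFin V) (Fintype.equivFin V).injective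
      exact hasLinearResolution_span_boundedExponents fun f hf g hg t _ h2 =>
        exists_best_tight_of_card_inter_le_two (by omega)
          (fun H H' h h' hne => h.card_inter_le_two hac hdeg h' hne) hg (h2.trans_le (hf.1 t))
    · rw [← pow_one (connectedIdeal K Tᶜ r), connectedIdeal_compl_pow hac (by omega)]
      have hd := fun m hm => degree_of_mem_boundedExponents m
        (goodSums_subset_boundedExponents hcard 1 hm)
      refine ⟨isEquigeneratedMonomialIdeal_span_monomial hd, ?_⟩
      rw [minimalMonomials_span_monomial hd, goodSums_one]
      rintro _ ⟨S, hS, rfl⟩ _ ⟨S', hS', rfl⟩ i hi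
      simp only [indicatorExponent_apply] at hi ⊢
      have hiS : i ∈ S := by by_contra h; simp [h] at hi
      have hiS' : i ∉ S' := by intro h; simp [h, hiS] at hi
      obtain ⟨j, hj, hjS, hbad⟩ := exists_exchange_of_card_inter_le_two (by omega) hsp hS.1 hS'.1
        hS'.2 hiS hiS'
      refine ⟨j, by simp [hj, hjS], insert j (S.erase i),
        ⟨by rw [card_insert_erase_of_mem hiS hjS, hS.1], hbad⟩, ?_⟩
      have hle : Finsupp.single i 1 ≤ indicatorExponent S := by
        rw [Finsupp.single_le_iff, indicatorExponent_apply, if_pos hiS]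
      refine add_right_cancel (b := Finsupp.single i 1) ?_
      rw [indicatorExponent_insert_erase hiS hjS, add_right_comm, tsub_add_cancel_of_le hle]
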